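/- Let $\mathfrak t$ be a finite-dimensional complex vector space and let $W \subset GL(\mathfrak t)$ be a finite subgroup generated by complex reflections, i.e. by automorphisms of finite order whose fixed locus is a hyperplane. Let $\mathcal A$ be the set of the fixed hyperplanes of all reflections in $W$, and let $L(\mathcal A)$ be the set of all intersections of elements of $\mathcal A$ (the empty intersection being $\mathfrak t$), on which $W$ acts. For $X \in L(\mathcal A)$ let $W_X \subset W$ be the subgroup of elements that fix every point of $X$. Regard $\mathfrak t$ as the scheme $\operatorname{Spec}\operatorname{Sym}\mathfrak t^\vee$, and put $\mathfrak t/W = \operatorname{Spec}\,(\operatorname{Sym}\mathfrak t^\vee)^W$; all schemes and morphisms are over $\mathbb C$. A *cameral cover* of a scheme $S$ is an $S$-scheme $C$ with a left action of $W$ over $S$ for which there are a surjective étale morphism $U \to S$, a morphism $U \to \mathfrak t/W$ and a $W$-equivariant isomorphism $U \times_{\mathfrak t/W} \mathfrak t \cong U \times_S C$ over $U$. A *pointed cameral cover* is a cameral cover together with a section $\sigma : S \to C$. Isomorphisms of cameral covers are $W$-equivariant isomorphisms over $S$; isomorphisms of pointed cameral covers are also required to carry one section to the other. For a subgroup $H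 \subset W$ let $Co(H,\mathfrak t) = \operatorname{Spec}\,(\operatorname{Sym}\mathfrak t^\vee / I_H)$, where $I_H$ is the ideal generated by the $H$-invariant polynomials that vanish at the origin, and let $\mathrm{ind}_H^W D = W \times_H D$ denote the balanced product, the quotient of $W \times D$ by the action $h\cdot(w,d) = (wh^{-1},hd)$ of $H$. Let $\sigma_X$ be the point of $\mathrm{ind}_{W_X}^W Co(W_X,\mathfrak t)$ given by $1 \in W$ and the origin. Then: 1. For each $X \in L(\mathcal A)$, $\mathrm{ind}_{W_X}^W Co(W_X,\mathfrak t)$ is a cameral cover of $\operatorname{Spec}\mathbb C$, and $X \mapsto (\mathrm{ind}_{W_X}^W Co(W_X,\mathfrak t), \sigma_X)$ induces a bijection from $L(\mathcal A)$ to the set of isomorphism classes of pointed cameral covers of $\operatorname{Spec}\mathbb C$. 2. $X \mapsto \mathrm{ind}_{W_X}^W Co(W_X,\mathfrak t)$ induces a bijection from the set of $W$-orbits in $L(\mathcal A)$ to the set of isomorphism classes of cameral covers of $\operatorname{Spec}\mathbb C$. In particular each cameral cover of $\operatorname{Spec}\mathbb C$ is isomorphic to $\mathrm{ind}_{W_X}^W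 Co(W_X,\mathfrak t)$ for some $X \in L(\mathcal A)$, and each pointed one to $(\mathrm{ind}_{W_X}^W Co(W_X,\mathfrak t), \sigma_X)$. -/

import Mathlib

open CategoryTheory CategoryTheory.Limits AlgebraicGeometry

noncomputable section

namespace Cameral

/-! ### Reflection arrangements -/

section Arrangement

variable {V : Type} [AddCommGroup V] [Module ℂ V]

/-- The fixed locus of a linear automorphism. -/
def fixedSpace (r : V ≃ₗ[ℂ] V) : Submodule ℂ V :=
  LinearMap.eqLocus (r : V →ₗ[ℂ] V) LinearMap.id

/-- A complex reflection: an automorphism of finite order whose fixed locus is a hyperplane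
(a maximal proper subspace). -/
def IsReflection (r : V ≃ₗ[ℂ] V) : Prop :=
  IsOfFinOrder r ∧ IsCoatom (fixedSpace r)

/-- A complex reflection group: a finite subgroup of `GL(V)` generated by complex reflections. -/
structure IsReflectionGroup (W : Subgroup (V ≃ₗ[ℂ] V)) : Prop where
  finite : Finite W
  closure_eq : Subgroup.closure {r | r ∈ W ∧ IsReflection r} = W

/-- The arrangement of mirrors: the fixed loci of all reflections in `W`. -/
def mirrors (W : Subgroup (V ≃ₗ[ℂ] V)) : Set (Submodule ℂ V) :=
  {a | ∃ r ∈ W, IsReflection r ∧ fixedSpace r = a}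

/-- The intersection poset `L(𝒜)` of the mirror arrangement: all intersections of mirrors,
the empty intersection being `V` itself. -/
def intersections (W : Subgroup (V ≃ₗ[ℂ] V)) : Set (Submodule ℂ V) :=
  {X | ∃ B ⊆ mirrors W, X = sInf B}

theorem map_fixedSpace (g r : V ≃ₗ[ℂ] V) :
    (fixedSpace r).map (g : V →ₗ[ℂ] V) = fixedSpace (g * r * g⁻¹) := by
  ext x
  simp only [fixedSpace, Submodule.mem_map, LinearMap.mem_eqLocus, LinearMap.id_apply,
    LinearEquiv.coe_coe, LinearEquiv.mul_apply]
  constructor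
  · rintro ⟨y, hy, rfl⟩
    have h : g⁻¹ (g y) = y := g.symm_apply_apply y
    rw [h, hy]
  · intro hx
    refine ⟨g⁻¹ x, ?_, g.apply_symm_apply x⟩
    apply g.injective
    rw [hx]
    exact (g.apply_symm_apply x).symm

theorem map_mem_mirrors {W : Subgroup (V ≃ₗ[ℂ] V)} {g : V ≃ₗ[ℂ] V} (hg : g ∈ W)
    {a : Submodule ℂ V} (ha : a ∈ mirrors W) : a.map (g : V →ₗ[ℂ] V) ∈ mirrors W := by
  obtain ⟨r, hr, ⟨hfin, hco⟩, rfl⟩ := ha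
  refine ⟨g * r * g⁻¹, W.mul_mem (W.mul_mem hg hr) (W.inv_mem hg), ⟨?_, ?_⟩,
    (map_fixedSpace g r).symm⟩
  · have h := (MulAut.conj g).toMonoidHom.isOfFinOrder hfin
    simpa using h
  · rw [← map_fixedSpace]
    exact ((Submodule.orderIsoMapComap g).isCoatom_iff _).2 hco

theorem map_mem_intersections {W : Subgroup (V ≃ₗ[ℂ] V)} {g : V ≃ₗ[ℂ] V} (hg : g ∈ W)
    {X : Submodule ℂ V} (hX : X ∈ intersections W) :
    X.map (g : V →ₗ[ℂ] V) ∈ intersections W := by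
  obtain ⟨B, hB, rfl⟩ := hX
  refine ⟨(fun a : Submodule ℂ V => a.map (g : V →ₗ[ℂ] V)) '' B, ?_, ?_⟩
  · rintro _ ⟨a, ha, rfl⟩
    exact map_mem_mirrors hg (hB ha)
  · have h := (Submodule.orderIsoMapComap g).map_sInf B
    rw [sInf_image]
    exact h

/-- `W` acts on `L(𝒜)` by `w • X = w(X)`. -/
instance intersectionsMulAction (W : Subgroup (V ≃ₗ[ℂ] V)) : MulAction W (intersections W) where
  smul w X := ⟨X.1.map ((w : V ≃ₗ[ℂ] V) : V →ₗ[ℂ] V), map_mem_intersections w.2 X.2⟩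
  one_smul X := Subtype.ext (Submodule.map_id X.1)
  mul_smul w v X := Subtype.ext
    (Submodule.map_comp ((v : V ≃ₗ[ℂ] V) : V →ₗ[ℂ] V) ((w : V ≃ₗ[ℂ] V) : V →ₗ[ℂ] V) X.1)

/-- The subgroup `W_X` of elements of `W` that fix every point of `X`. -/
def pointwiseStabilizer (W : Subgroup (V ≃ₗ[ℂ] V)) (X : Submodule ℂ V) : Subgroup W :=
  fixingSubgroup W (X : Set V)

end Arrangement

/-! ### The coordinate ring of `V` -/

section Coordinates

variable (V : Type) [AddCommGroup V] [Module ℂ V]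

/-- The ring `Sym(V^∨)` of polynomial functions on `V`. -/
abbrev Coord : Type := SymmetricAlgebra ℂ (Module.Dual ℂ V)

variable {V}

/-- The action of `g` on polynomial functions, `ξ ↦ ξ ∘ g⁻¹` on linear forms. -/
def coordHom (g : V ≃ₗ[ℂ] V) : Coord V →ₐ[ℂ] Coord V :=
  SymmetricAlgebra.lift
    (SymmetricAlgebra.ι ℂ (Module.Dual ℂ V) ∘ₗ ((g⁻¹ : V ≃ₗ[ℂ] V) : V →ₗ[ℂ] V).dualMap)

theorem coordHom_ι (g : V ≃ₗ[ℂ] V) (ξ : Module.Dual ℂ V) :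
    coordHom g (SymmetricAlgebra.ι ℂ (Module.Dual ℂ V) ξ) =
      SymmetricAlgebra.ι ℂ (Module.Dual ℂ V) (((g⁻¹ : V ≃ₗ[ℂ] V) : V →ₗ[ℂ] V).dualMap ξ) :=
  SymmetricAlgebra.lift_ι_apply _ ξ

theorem coordHom_one : coordHom (1 : V ≃ₗ[ℂ] V) = AlgHom.id ℂ (Coord V) :=
  SymmetricAlgebra.algHom_ext (LinearMap.ext fun ξ => coordHom_ι 1 ξ)

theorem coordHom_mul (g h : V ≃ₗ[ℂ] V) : coordHom (g * h) = (coordHom g).comp (coordHom h) := by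
  refine SymmetricAlgebra.algHom_ext (LinearMap.ext fun ξ => ?_)
  refine (coordHom_ι (g * h) ξ).trans (Eq.symm ?_)
  refine (congrArg (coordHom g) (coordHom_ι h ξ)).trans ?_
  refine (coordHom_ι g _).trans ?_
  rw [mul_inv_rev]
  rfl

instance coordMulSemiringAction : MulSemiringAction (V ≃ₗ[ℂ] V) (Coord V) where
  smul g a := coordHom g a
  one_smul a := congrArg (fun f : Coord V →ₐ[ℂ] Coord V => f a) coordHom_one
  mul_smul g h a := congrArg (fun f : Coord V →ₐ[ℂ] Coord V => f a) (coordHom_mul g h)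
  smul_zero g := map_zero (coordHom g)
  smul_add g := map_add (coordHom g)
  smul_one g := map_one (coordHom g)
  smul_mul g := map_mul (coordHom g)

theorem smul_coord_def (g : V ≃ₗ[ℂ] V) (a : Coord V) : g • a = coordHom g a := rfl

instance coordSMulCommClass : SMulCommClass (V ≃ₗ[ℂ] V) ℂ (Coord V) where
  smul_comm g c a := map_smul (coordHom g) c a

variable (V) in
/-- Evaluation of polynomial functions at the origin. -/
def evalZero : Coord V →ₐ[ℂ] ℂ := SymmetricAlgebra.algebraMapInv

end Coordinates

/-! ### Group actions on affine schemes -/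

section SpecAction

variable {B : Type} [CommRing B]

/-- The `B`-scheme `Spec A` of a `B`-algebra `A`. -/
def specOver (B A : Type) [CommRing B] [CommRing A] [Algebra B A] : Over (Spec (.of B)) :=
  Over.mk (Spec.map (CommRingCat.ofHom (algebraMap B A)))

variable {A A' : Type} [CommRing A] [Algebra B A] [CommRing A'] [Algebra B A']

theorem specMap_comp_algebraMap (f : A →ₐ[B] A') :
    Spec.map (CommRingCat.ofHom (f : A →+* A')) ≫ Spec.map (CommRingCat.ofHom (algebraMap B A)) =
      Spec.map (CommRingCat.ofHom (algebraMap B A')) := by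
  rw [← Spec.map_comp, ← CommRingCat.ofHom_comp, f.comp_algebraMap]

/-- The morphism of `B`-schemes `Spec A' ⟶ Spec A` given by a homomorphism of `B`-algebras
`A → A'`. -/
def specMap (f : A →ₐ[B] A') : specOver B A' ⟶ specOver B A :=
  Over.homMk (Spec.map (CommRingCat.ofHom (f : A →+* A'))) (specMap_comp_algebraMap f)

variable {G : Type} [Group G]

/-- If `G` acts on a `B`-algebra `A`, then `G` acts on the left on the `B`-scheme `Spec A`,
with `g` acting through the ring automorphism `g⁻¹`. For a category `𝒞`, an object of
`Action 𝒞 G` is an object of `𝒞` with a left action of `G`, so an object of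
`Action (Over S) G` is an `S`-scheme with a left action of `G` over `S`. -/
def specAction (α : G →* (A ≃ₐ[B] A)) : Action (Over (Spec (.of B))) G where
  V := specOver B A
  ρ :=
    { toFun g := specMap (α g⁻¹ : A →ₐ[B] A)
      map_one' := by
        apply Over.OverMorphism.ext
        rw [inv_one, map_one]
        exact Spec.map_id _
      map_mul' g h := by
        apply Over.OverMorphism.ext
        rw [mul_inv_rev, map_mul, End.mul_def, Over.comp_left]
        exact Spec.map_comp (CommRingCat.ofHom ((α g⁻¹ : A →ₐ[B] A) : A →+* A))
          (CommRingCat.ofHom ((α h⁻¹ : A →ₐ[B] A) : A →+* A)) }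

/-- The section of `Spec A → Spec B` given by a homomorphism of `B`-algebras `A → B`. -/
def specSection (ε : A →ₐ[B] B) : Over.mk (𝟙 (Spec (.of B))) ⟶ specOver B A :=
  Over.homMk (Spec.map (CommRingCat.ofHom (ε : A →+* B)))
    ((specMap_comp_algebraMap ε).trans (Spec.map_id _))

end SpecAction

/-! ### Cameral covers -/

section CameralCover

variable {V : Type} [AddCommGroup V] [Module ℂ V] (W : Subgroup (V ≃ₗ[ℂ] V))

/-- The algebra of `W`-invariant polynomial functions on `V`. -/
abbrev Invariants : Subalgebra ℂ (Coord V) := FixedPoints.subalgebra ℂ (Coord V) W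

/-- The quotient scheme `V/W`. -/
def quotientScheme : Scheme.{0} := Spec (.of (Invariants W))

/-- The structure morphism `V/W ⟶ Spec ℂ`. -/
def quotientToSpec : quotientScheme W ⟶ Spec (.of ℂ) :=
  Spec.map (CommRingCat.ofHom (algebraMap ℂ (Invariants W)))

/-- The scheme `V` over `V/W`, with its action of `W`. -/
def tautologicalCover : Action (Over (quotientScheme W)) W :=
  specAction (MulSemiringAction.toAlgAut W (Invariants W) (Coord V))

/-- A `W`-scheme `C` over the complex scheme `s : S ⟶ Spec ℂ` is a `(W, V)`-cameral cover if there
are a surjective étale morphism `u : U ⟶ S`, a morphism `φ : U ⟶ V/W` of complex schemes and a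
`W`-equivariant isomorphism `U ×_{V/W} V ≅ U ×_S C` over `U`. -/
def IsCameralCover {S : Scheme.{0}} (s : S ⟶ Spec (.of ℂ)) : ObjectProperty (Action (Over S) W) :=
  fun C => ∃ (U : Scheme.{0}) (u : U ⟶ S) (φ : U ⟶ quotientScheme W),
    Etale u ∧ Surjective u ∧ φ ≫ quotientToSpec W = u ≫ s ∧
    Nonempty (((Over.pullback φ).mapAction W).obj (tautologicalCover W) ≅
      ((Over.pullback u).mapAction W).obj C)

/-- Cameral covers of `S`; morphisms are the `W`-equivariant morphisms over `S`. -/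
abbrev CameralCover {S : Scheme.{0}} (s : S ⟶ Spec (.of ℂ)) := (IsCameralCover W s).FullSubcategory

/-- Isomorphism classes of cameral covers of `S`. -/
abbrev CameralCoverClass {S : Scheme.{0}} (s : S ⟶ Spec (.of ℂ)) :=
  Quotient (isIsomorphicSetoid (CameralCover W s))

/-- A cameral cover of `S` together with a section over `S`. -/
structure PointedCameralCover {S : Scheme.{0}} (s : S ⟶ Spec (.of ℂ)) where
  cover : Action (Over S) W
  isCameralCover : IsCameralCover W s cover
  pt : Over.mk (𝟙 S) ⟶ cover.V

/-- Two pointed cameral covers are isomorphic if there is a `W`-equivariant isomorphism over `S`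
that carries one section to the other. -/
instance pointedSetoid {S : Scheme.{0}} (s : S ⟶ Spec (.of ℂ)) :
    Setoid (PointedCameralCover W s) where
  r C D := ∃ e : C.cover ≅ D.cover, C.pt ≫ e.hom.hom = D.pt
  iseqv :=
    { refl := fun C => ⟨Iso.refl _, Category.comp_id _⟩
      symm := by
        rintro C D ⟨e, he⟩
        refine ⟨e.symm, ?_⟩
        rw [← he, Category.assoc, Iso.symm_hom, Action.hom_inv_hom, Category.comp_id]
      trans := by
        rintro C D E ⟨e, he⟩ ⟨f, hf⟩
        refine ⟨e.trans f, ?_⟩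
        rw [Iso.trans_hom, Action.comp_hom, ← Category.assoc, he, hf] }

/-- Isomorphism classes of pointed cameral covers of `S`. -/
abbrev PointedCameralCoverClass {S : Scheme.{0}} (s : S ⟶ Spec (.of ℂ)) :=
  Quotient (pointedSetoid W s)

end CameralCover

/-! ### The fibre over the origin -/

section Coinvariants

variable {V : Type} [AddCommGroup V] [Module ℂ V] {W : Subgroup (V ≃ₗ[ℂ] V)} (H : Subgroup W)

/-- The ideal generated by the `H`-invariant polynomial functions that vanish at the origin. -/
def coinvariantIdeal : Ideal (Coord V) :=
  Ideal.span {a | (∀ h : H, h • a = a) ∧ evalZero V a = 0}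

/-- The coinvariant algebra of `(H, V)`, that is, the coordinate ring of the fibre `Co(H, V)` of
`V → V/H` over the origin. -/
abbrev Coinvariants : Type := Coord V ⧸ coinvariantIdeal H

theorem map_coinvariantIdeal (h : H) :
    coinvariantIdeal H =
      (coinvariantIdeal H).map (MulSemiringAction.toAlgAut H ℂ (Coord V) h) := by
  rw [coinvariantIdeal, Ideal.map_span]
  congr 1
  ext a
  simp only [Set.mem_image, Set.mem_ofPred_eq]
  constructor
  · intro ha
    exact ⟨a, ha, ha.1 h⟩
  · rintro ⟨b, hb, rfl⟩
    have e : (MulSemiringAction.toAlgAut H ℂ (Coord V) h) b = b := hb.1 h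
    rw [e]
    exact hb

/-- The action of `H` on the coinvariant algebra induced by its action on polynomial functions. -/
def coinvariantsAut : H →* (Coinvariants H ≃ₐ[ℂ] Coinvariants H) where
  toFun h := Ideal.quotientEquivAlg _ _ (MulSemiringAction.toAlgAut H ℂ (Coord V) h)
    (map_coinvariantIdeal H h)
  map_one' := by
    ext x
    obtain ⟨a, rfl⟩ := Ideal.Quotient.mk_surjective x
    exact congrArg (Ideal.Quotient.mk (coinvariantIdeal H)) (one_smul H a)
  map_mul' g h := by
    ext x
    obtain ⟨a, rfl⟩ := Ideal.Quotient.mk_surjective x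
    exact congrArg (Ideal.Quotient.mk (coinvariantIdeal H)) (mul_smul g h a)

/-- The closed point of `Co(H, V)`: evaluation at the origin. -/
def coinvariantsPoint : Coinvariants H →ₐ[ℂ] ℂ :=
  Ideal.Quotient.liftₐ (coinvariantIdeal H) (evalZero V) (fun _ ha =>
    (Ideal.span_le (I := RingHom.ker (evalZero V))).2 (fun _ hb => hb.2) ha)

end Coinvariants

/-! ### Induction -/

section Induction

variable {G : Type} [Group G] {H : Subgroup G} {R : Type} [CommRing R] [Algebra ℂ R]
  (β : H →* (R ≃ₐ[ℂ] R))

/-- For a finite group `G`, a subgroup `H` and a ring `R` of functions on an affine `H`-scheme `D`,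
the ring of functions on the balanced product `G ×_H D`: the functions on `G × D`, that is, the
functions `f : G → R`, which are invariant under `h • (g, d) = (g h⁻¹, h d)`. -/
def inducedAlgebra : Subalgebra ℂ (G → R) where
  carrier := {f | ∀ (h : H) (g : G), f (g * (h : G)⁻¹) = β h (f g)}
  mul_mem' {a b} ha hb h g := by simp only [Pi.mul_apply, ha h g, hb h g, map_mul]
  add_mem' {a b} ha hb h g := by simp only [Pi.add_apply, ha h g, hb h g, map_add]
  algebraMap_mem' c h g := ((β h).commutes c).symm

/-- The left translation action `(g • f)(x) = f(g⁻¹ x)` on functions on `G ×_H D`, which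
corresponds to the action `g • (x, d) = (g x, d)` on `G ×_H D`. -/
def inducedAut : G →* (inducedAlgebra β ≃ₐ[ℂ] inducedAlgebra β) where
  toFun g :=
    { toFun f := ⟨fun x => f.1 (g⁻¹ * x), fun h x =>
        (congrArg f.1 (mul_assoc _ _ _).symm).trans (f.2 h (g⁻¹ * x))⟩
      invFun f := ⟨fun x => f.1 (g * x), fun h x =>
        (congrArg f.1 (mul_assoc _ _ _).symm).trans (f.2 h (g * x))⟩
      left_inv f := Subtype.ext (funext fun x => by simp)
      right_inv f := Subtype.ext (funext fun x => by simp)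
      map_mul' _ _ := rfl
      map_add' _ _ := rfl
      commutes' _ := rfl }
  map_one' := by
    ext f x
    simp
  map_mul' g k := by
    refine AlgEquiv.ext fun f => Subtype.ext (funext fun x => congrArg f.1 ?_)
    rw [mul_inv_rev, mul_assoc]

/-- The balanced product `ind_H^G D = G ×_H D` for `D = Spec R`, with its left action of `G`. -/
def induced : Action (Over (Spec (.of ℂ))) G := specAction (inducedAut β)

/-- The point `(1, ε)` of `G ×_H D` for a point `ε` of `D`. -/
def inducedPoint (ε : R →ₐ[ℂ] ℂ) : Over.mk (𝟙 (Spec (.of ℂ))) ⟶ (induced β).V :=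
  specSection
    (ε.comp ((Pi.evalAlgHom ℂ (fun _ : G => R) 1).comp (inducedAlgebra β).val))

end Induction

section InducedCo

variable {V : Type} [AddCommGroup V] [Module ℂ V] (W : Subgroup (V ≃ₗ[ℂ] V))

/-- The `W`-scheme `ind_{W_X}^W Co(W_X, V)`. -/
def indCo (X : Submodule ℂ V) : Action (Over (Spec (.of ℂ))) W :=
  induced (coinvariantsAut (pointwiseStabilizer W X))

/-- The section of `ind_{W_X}^W Co(W_X, V)` induced from the closed point of `Co(W_X, V)`. -/
def indCoPt (X : Submodule ℂ V) : Over.mk (𝟙 (Spec (.of ℂ))) ⟶ (indCo W X).V :=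
  inducedPoint (coinvariantsAut (pointwiseStabilizer W X))
    (coinvariantsPoint (pointwiseStabilizer W X))

end InducedCo

end Cameral

end

/-!
A nonempty étale scheme over `Spec ℂ` has a complex point, so a cameral cover of `Spec ℂ` is the
fibre of the quotient map `V → V/W` over a complex point. A section of it is a vector `v` in that
fibre, and one exists because `V → V/W` is finite and surjective. The fibre is
`W ×_{W_v} (v + Co(W_v, V))`: polynomial functions which are close to the idempotents of the fibre
separate the points of the orbit, and averaging over `W` compares the ideals of `W` and `W_v` at
`v`.

The stabilizers `W_v` are exactly the subgroups `W_X`: a generic vector of `X` has stabilizer `W_X`,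
and conversely, by Steinberg's theorem, `W_v` is generated by the reflections that fix `v`. For the
latter, the divided differences `(a - r a) / α_r` show that `ℂ[V]` is flat over `ℂ[V]^W`, so
functions on `V ×_{V/W} V` are families of polynomials on the union of the graphs of the elements of
`W` and form a flat `ℂ[V]`-module. By flatness the union of the graphs is connected in codimension
one near `(v, v)`, that is, through mirrors containing `v`.

Up to isomorphism the point `σ_X` determines `X`, because its stabilizer is `W_X`. Forgetting it
amounts to passing to `W`-orbits, because the sections of a fibre form a single `W`-orbit.
-/

noncomputable section

namespace Cameral

open SymmetricAlgebra (ι)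

/-! ### Polynomial functions -/

section PolynomialFunctions

variable {V : Type} [AddCommGroup V] [Module ℂ V]

/-- Evaluation of polynomial functions at a point. -/
def evalAt (v : V) : Coord V →ₐ[ℂ] ℂ := SymmetricAlgebra.lift (Module.Dual.eval ℂ V v)

@[simp]
theorem evalAt_ι (v : V) (ξ : Module.Dual ℂ V) : evalAt v (ι ℂ _ ξ) = ξ v :=
  SymmetricAlgebra.lift_ι_apply _ ξ

theorem evalAt_zero : evalAt (0 : V) = evalZero V := by
  ext ξ
  simp [evalZero, SymmetricAlgebra.algebraMapInv_ι]

theorem evalAt_comp_coordHom (g : V ≃ₗ[ℂ] V) (v : V) :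
    (evalAt v).comp (coordHom g) = evalAt (g⁻¹ • v) := by
  ext ξ
  simp [coordHom_ι]

theorem evalAt_smul {W : Subgroup (V ≃ₗ[ℂ] V)} (w : W) (v : V) (a : Coord V) :
    evalAt v (w • a) = evalAt (w⁻¹ • v) a :=
  DFunLike.congr_fun (evalAt_comp_coordHom (w : V ≃ₗ[ℂ] V) v) a

theorem evalAt_injective : Function.Injective (evalAt : V → Coord V →ₐ[ℂ] ℂ) := by
  refine fun v w h => sub_eq_zero.1 ((Module.forall_dual_apply_eq_zero_iff ℂ _).1 fun ξ => ?_)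
  rw [map_sub, ← evalAt_ι, ← evalAt_ι, h, sub_self]

theorem ι_injective : Function.Injective (ι ℂ (Module.Dual ℂ V)) := by
  intro ξ η h
  ext v
  rw [← evalAt_ι, ← evalAt_ι, h]

instance (W : Subgroup (V ≃ₗ[ℂ] V)) : FaithfulSMul W (Coord V) where
  eq_of_smul_eq_smul {g h} hgh := by
    refine inv_injective (Subtype.ext (LinearEquiv.ext fun v => evalAt_injective ?_))
    exact AlgHom.ext fun a => (evalAt_smul g v a).symm.trans (hgh a ▸ evalAt_smul h v a)

/-- Translation by `v` of polynomial functions, `f ↦ f(· + v)`. -/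
def translate (v : V) : Coord V →ₐ[ℂ] Coord V :=
  SymmetricAlgebra.lift (ι ℂ _ + Algebra.linearMap ℂ (Coord V) ∘ₗ Module.Dual.eval ℂ V v)

@[simp]
theorem translate_ι (v : V) (ξ : Module.Dual ℂ V) :
    translate v (ι ℂ _ ξ) = ι ℂ _ ξ + algebraMap ℂ (Coord V) (ξ v) :=
  SymmetricAlgebra.lift_ι_apply _ ξ

theorem translate_translate (v w : V) (a : Coord V) :
    translate v (translate w a) = translate (v + w) a := by
  have h : (translate v).comp (translate w) = translate (v + w) := by
    ext ξ
    simp [add_assoc]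
  exact DFunLike.congr_fun h a

theorem translate_zero : translate (0 : V) = AlgHom.id ℂ (Coord V) := by
  ext ξ
  simp

theorem evalAt_translate (v w : V) (a : Coord V) :
    evalAt w (translate v a) = evalAt (w + v) a := by
  have h : (evalAt w).comp (translate v) = evalAt (w + v) := by
    ext ξ
    simp
  exact DFunLike.congr_fun h a

theorem translate_smul {W : Subgroup (V ≃ₗ[ℂ] V)} {w : W} {v : V} (hv : w • v = v) (a : Coord V) :
    translate v (w • a) = w • translate v a := by
  have hv' : w⁻¹ • v = v := inv_smul_eq_iff.2 hv.symm
  change (w : V ≃ₗ[ℂ] V)⁻¹ v = v at hv'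
  have h : (translate v).comp (coordHom (w : V ≃ₗ[ℂ] V)) = (coordHom w.1).comp (translate v) := by
    ext ξ
    simp [coordHom_ι, hv']
  exact DFunLike.congr_fun h a

variable [FiniteDimensional ℂ V]

theorem exists_eq_evalAt (ψ : Coord V →ₐ[ℂ] ℂ) : ∃ v, ψ = evalAt v := by
  refine ⟨(Module.evalEquiv ℂ V).symm (ψ.toLinearMap ∘ₗ ι ℂ _), ?_⟩
  ext ξ
  simp [Module.apply_evalEquiv_symm_apply]

variable (V) in
/-- Linear coordinates identify polynomial functions with polynomials. -/
def coordEquiv : Coord V ≃ₐ[ℂ] MvPolynomial (Fin (Module.finrank ℂ (Module.Dual ℂ V))) ℂ :=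
  SymmetricAlgebra.equivMvPolynomial (Module.finBasis ℂ (Module.Dual ℂ V))

instance : UniqueFactorizationMonoid (Coord V) :=
  (coordEquiv V).symm.toMulEquiv.uniqueFactorizationMonoid inferInstance

instance : Algebra.FiniteType ℂ (Coord V) :=
  Algebra.FiniteType.equiv inferInstance (coordEquiv V).symm

theorem mem_of_forall_evalAt_eq_zero {P : Ideal (Coord V)} [P.IsPrime] {a : Coord V}
    (h : ∀ v, (∀ p ∈ P, evalAt v p = 0) → evalAt v a = 0) : a ∈ P := by
  let Q := P.comap (coordEquiv V).symm
  suffices coordEquiv V a ∈ Q by simpa [Q] using this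
  rw [← MvPolynomial.IsPrime.vanishingIdeal_zeroLocus (K := ℂ) Q,
    MvPolynomial.mem_vanishingIdeal_iff]
  intro x hx
  obtain ⟨v, hv⟩ := exists_eq_evalAt ((MvPolynomial.aeval x).comp (coordEquiv V).toAlgHom)
  have hva (b : Coord V) : evalAt v b = MvPolynomial.aeval x (coordEquiv V b) :=
    (DFunLike.congr_fun hv b).symm
  rw [← hva]
  refine h v fun p hp => ?_
  rw [hva]
  exact hx _ (by simpa [Q] using hp)

theorem exists_evalAt_eq_one_of_notMem (S : Finset V) {x : V} (hx : x ∉ S) :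
    ∃ a : Coord V, evalAt x a = 1 ∧ ∀ y ∈ S, evalAt y a = 0 := by
  have h : ∀ y ∈ S, ∃ a : Coord V, evalAt x a = 1 ∧ evalAt y a = 0 := by
    intro y hy
    obtain ⟨ξ, hξ⟩ := not_forall.1 (mt (Module.forall_dual_apply_eq_zero_iff ℂ (x - y)).1
      (sub_ne_zero.2 (ne_of_mem_of_not_mem hy hx).symm))
    refine ⟨(ξ (x - y))⁻¹ • (ι ℂ _ ξ - algebraMap ℂ (Coord V) (ξ y)), ?_, ?_⟩
    · simpa [sub_eq_zero] using inv_mul_cancel₀ hξ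
    · simp
  choose! a hx hS using h
  refine ⟨∏ y ∈ S, a y, ?_, fun y hy => ?_⟩
  · rw [map_prod, Finset.prod_eq_one hx]
  · rw [map_prod, Finset.prod_eq_zero hy (hS y hy)]

end PolynomialFunctions

section Degree

theorem totalDegree_aeval_le {R σ τ : Type*} [CommSemiring R] {f : σ → MvPolynomial τ R}
    (hf : ∀ i, (f i).totalDegree ≤ 1) (p : MvPolynomial σ R) :
    (MvPolynomial.aeval f p).totalDegree ≤ p.totalDegree := by
  rw [MvPolynomial.aeval_def, MvPolynomial.eval₂_eq]
  refine MvPolynomial.totalDegree_finsetSum_le fun d hd => ?_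
  calc _ ≤ ∑ i ∈ d.support, (f i ^ d i).totalDegree := by
        refine (MvPolynomial.totalDegree_mul _ _).trans ?_
        rw [MvPolynomial.algebraMap_eq, MvPolynomial.totalDegree_C, zero_add]
        exact MvPolynomial.totalDegree_finsetProd _ _
    _ ≤ ∑ i ∈ d.support, d i := Finset.sum_le_sum fun i _ =>
        (MvPolynomial.totalDegree_pow _ _).trans <|
          (Nat.mul_le_mul_left _ (hf i)).trans_eq (mul_one _)
    _ ≤ p.totalDegree := MvPolynomial.le_totalDegree hd

variable {V : Type} [AddCommGroup V] [Module ℂ V] [FiniteDimensional ℂ V]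

/-- The degree of a polynomial function, `0` for the zero function. -/
def degree (a : Coord V) : ℕ := (coordEquiv V a).totalDegree

theorem degree_mul {a b : Coord V} (ha : a ≠ 0) (hb : b ≠ 0) :
    degree (a * b) = degree a + degree b := by
  rw [degree, map_mul, MvPolynomial.totalDegree_mul_of_isDomain (by simpa) (by simpa)]
  rfl

theorem degree_ι_le (ξ : Module.Dual ℂ V) : degree (ι ℂ _ ξ) ≤ 1 := by
  rw [degree, ← MvPolynomial.mem_restrictTotalDegree,
    ← (Module.finBasis ℂ (Module.Dual ℂ V)).sum_repr ξ, map_sum, map_sum]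
  refine Submodule.sum_mem _ fun i _ => ?_
  rw [map_smul, map_smul, coordEquiv, SymmetricAlgebra.equivMvPolynomial_ι_apply]
  refine Submodule.smul_mem _ _ ?_
  rw [MvPolynomial.mem_restrictTotalDegree, MvPolynomial.totalDegree_X]

theorem exists_eq_algebraMap_of_degree_eq_zero {a : Coord V} (h : degree a = 0) :
    ∃ k : ℂ, a = algebraMap ℂ (Coord V) k := by
  refine ⟨MvPolynomial.coeff 0 (coordEquiv V a), (coordEquiv V).injective ?_⟩
  rw [AlgEquiv.commutes]
  exact MvPolynomial.totalDegree_eq_zero_iff_eq_C.1 h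

theorem isUnit_of_degree_eq_zero {a : Coord V} (ha : a ≠ 0) (h : degree a = 0) : IsUnit a := by
  obtain ⟨k, rfl⟩ := exists_eq_algebraMap_of_degree_eq_zero h
  exact (IsUnit.mk0 k fun hk => ha (by rw [hk, map_zero])).map _

theorem degree_ι {ξ : Module.Dual ℂ V} (hξ : ξ ≠ 0) : degree (ι ℂ _ ξ) = 1 := by
  refine le_antisymm (degree_ι_le ξ) (Nat.one_le_iff_ne_zero.2 fun h => hξ ?_)
  obtain ⟨k, hk⟩ := exists_eq_algebraMap_of_degree_eq_zero h
  have hk0 : k = 0 := by simpa using (congrArg (evalAt (0 : V)) hk).symm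
  exact ι_injective (by rw [hk, hk0, map_zero, map_zero])

theorem prime_ι {ξ : Module.Dual ℂ V} (hξ : ξ ≠ 0) : Prime (ι ℂ _ ξ) := by
  have hdeg := degree_ι hξ
  have hξ0 : ι ℂ _ ξ ≠ 0 := (map_ne_zero_iff _ ι_injective).2 hξ
  refine Irreducible.prime ⟨fun hu => ?_, fun a b hab => ?_⟩
  · simpa using hu.map (evalAt (0 : V))
  · have ha : a ≠ 0 := left_ne_zero_of_mul (hab ▸ hξ0)
    have hb : b ≠ 0 := right_ne_zero_of_mul (hab ▸ hξ0)
    rw [hab, degree_mul ha hb] at hdeg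
    exact (Nat.eq_zero_or_pos (degree a)).imp (isUnit_of_degree_eq_zero ha)
      fun _ => isUnit_of_degree_eq_zero hb (by lia)

theorem degree_sub_le (a b : Coord V) : degree (a - b) ≤ max (degree a) (degree b) := by
  rw [degree, map_sub]
  exact MvPolynomial.totalDegree_sub _ _

theorem degree_smul_le (g : V ≃ₗ[ℂ] V) (a : Coord V) : degree (g • a) ≤ degree a := by
  let e := coordEquiv V
  have h : (e.toAlgHom.comp (coordHom g)).comp e.symm.toAlgHom =
      MvPolynomial.aeval fun i => e (g • e.symm (MvPolynomial.X i)) := by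
    ext i : 1
    simp [smul_coord_def]
  have h' : e (g • a) = MvPolynomial.aeval (fun i => e (g • e.symm (MvPolynomial.X i))) (e a) := by
    rw [← h]
    simp [smul_coord_def]
  rw [degree, h']
  refine totalDegree_aeval_le (fun i => ?_) _
  rw [show e.symm (MvPolynomial.X i) = ι ℂ _ _ from
    SymmetricAlgebra.equivMvPolynomial_symm_X _ i, smul_coord_def, coordHom_ι]
  exact degree_ι_le _

end Degree

/-! ### Flatness over invariants -/

section IteratedKer

variable {B M κ : Type*} [CommRing B] [AddCommGroup M] [Module B M]

/-- The submodule of the elements which are annihilated by all products of `d` members of a family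
of endomorphisms. -/
def iteratedKer (Δ : κ → Module.End B M) : ℕ → Submodule B M
  | 0 => ⊥
  | d + 1 => ⨅ i, (iteratedKer Δ d).comap (Δ i)

variable {Δ : κ → Module.End B M}

theorem mem_iteratedKer_succ {d : ℕ} {x : M} :
    x ∈ iteratedKer Δ (d + 1) ↔ ∀ i, Δ i x ∈ iteratedKer Δ d := by
  simp only [iteratedKer, Submodule.mem_iInf, Submodule.mem_comap]

theorem iteratedKer_mono : Monotone (iteratedKer Δ) := by
  refine monotone_nat_of_le_succ fun d => ?_
  induction d with
  | zero => exact bot_le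
  | succ d ih => exact fun x hx => mem_iteratedKer_succ.2 fun i => ih (mem_iteratedKer_succ.1 hx i)

theorem mem_iteratedKer_of_lt {δ : M → ℕ} (hδ : ∀ i x, Δ i x ≠ 0 → δ (Δ i x) < δ x) {d : ℕ} {x : M}
    (hx : δ x < d) : x ∈ iteratedKer Δ d := by
  induction d generalizing x with
  | zero => exact absurd hx (Nat.not_lt_zero _)
  | succ d ih =>
    refine mem_iteratedKer_succ.2 fun i => ?_
    by_cases h0 : Δ i x = 0
    · exact h0 ▸ zero_mem _
    · exact ih ((hδ i x h0).trans_le (Nat.lt_succ_iff.1 hx))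

open TensorProduct in
theorem exists_mem_iteratedKer_rTensor (hΔ : ∀ x, ∃ d, x ∈ iteratedKer Δ d) (N : Type*)
    [AddCommGroup N] [Module B N] (z : M ⊗[B] N) :
    ∃ d, z ∈ iteratedKer (fun i => (Δ i).rTensor N) d := by
  induction z with
  | zero => exact ⟨0, zero_mem _⟩
  | add z w hz hw =>
    obtain ⟨m, hm⟩ := hz
    obtain ⟨n, hn⟩ := hw
    exact ⟨max m n, add_mem (iteratedKer_mono (le_max_left m n) hm)
      (iteratedKer_mono (le_max_right m n) hn)⟩
  | tmul x y =>
    obtain ⟨d, hd⟩ := hΔ x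
    refine ⟨d, ?_⟩
    induction d generalizing x with
    | zero => rw [(Submodule.mem_bot B).1 hd, zero_tmul]; exact zero_mem _
    | succ d ih => exact mem_iteratedKer_succ.2 fun i => ih _ (mem_iteratedKer_succ.1 hd i)

end IteratedKer

section Flatness

theorem smul_sum_smul {G M : Type*} [Group G] [Fintype G] [AddCommMonoid M] [DistribMulAction G M]
    (g : G) (x : M) : g • ∑ h : G, h • x = ∑ h : G, h • x := by
  rw [Finset.smul_sum]
  exact Fintype.sum_equiv (Equiv.mulLeft g) _ _ fun h => smul_smul g h x

instance {R A G : Type*} [CommRing R] [CommRing A] [Algebra R A] [Group G] [MulSemiringAction G A]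
    [SMulCommClass G R A] : Algebra.IsInvariant (FixedPoints.subalgebra R A G) A G :=
  ⟨fun a ha => ⟨⟨a, ha⟩, rfl⟩⟩

open TensorProduct

attribute [local instance] SMulCommClass.symm

variable {B A G : Type*} [CommRing B] [CommRing A] [Algebra B A] [Group G]
  [MulSemiringAction G A] [SMulCommClass G B A]

variable (B A G) in
/-- The Reynolds operator, the average over a finite group of order invertible in `B`. The sum is
`finsum`, hence only meaningful for finite `G`. -/
def reynolds [Invertible (Nat.card G : B)] : Module.End B A :=
  ⅟(Nat.card G : B) • ∑ᶠ g : G, DistribSMul.toLinearMap B A g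

theorem reynolds_apply [Fintype G] [Invertible (Nat.card G : B)] (a : A) :
    reynolds B A G a = ⅟(Nat.card G : B) • ∑ g : G, g • a := by
  simp [reynolds, finsum_eq_sum_of_fintype]

theorem smul_reynolds [Finite G] [Invertible (Nat.card G : B)] (g : G) (a : A) :
    g • reynolds B A G a = reynolds B A G a := by
  have := Fintype.ofFinite G
  rw [reynolds_apply, smul_comm, smul_sum_smul]

theorem rTensor_reynolds_eq_self [Finite G] [Invertible (Nat.card G : B)] {N : Type*}
    [AddCommGroup N] [Module B N] {z : A ⊗[B] N} (hz : ∀ g : G, g • z = z) :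
    (reynolds B A G).rTensor N z = z := by
  have := Fintype.ofFinite G
  have h (g : G) : (DistribSMul.toLinearMap B A g).rTensor N z = z :=
    (congrArg (fun f => f z) (show _ = DistribSMul.toLinearMap B _ g from
      TensorProduct.ext' fun _ _ => rfl)).trans (hz g)
  rw [reynolds, finsum_eq_sum_of_fintype, LinearMap.rTensor_smul, ← LinearMap.coe_rTensorHom,
    map_sum, LinearMap.smul_apply, LinearMap.sum_apply]
  simp only [LinearMap.coe_rTensorHom, h, Finset.sum_const, Finset.card_univ]
  rw [← Nat.card_eq_fintype_card, ← Nat.cast_smul_eq_nsmul B, invOf_smul_smul]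

variable [Algebra.IsInvariant B A G]

theorem exists_rTensor_reynolds_eq_one_tmul [Finite G] [Invertible (Nat.card G : B)] {N : Type*}
    [AddCommGroup N] [Module B N] (z : A ⊗[B] N) :
    ∃ y, (reynolds B A G).rTensor N z = 1 ⊗ₜ y := by
  induction z with
  | zero => exact ⟨0, by rw [map_zero, tmul_zero]⟩
  | add z w hz hw =>
    obtain ⟨x, hx⟩ := hz
    obtain ⟨y, hy⟩ := hw
    exact ⟨x + y, by rw [map_add, hx, hy, tmul_add]⟩
  | tmul a y =>
    obtain ⟨b, hb⟩ := Algebra.IsInvariant.isInvariant (A := B) (reynolds B A G a)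
      fun g => smul_reynolds g a
    exact ⟨b • y, by
      rw [LinearMap.rTensor_tmul, ← hb, Algebra.algebraMap_eq_smul_one, smul_tmul]⟩

theorem eq_zero_of_smul_eq_of_lTensor_subtype_eq_zero [FaithfulSMul B A] [Finite G]
    [Invertible (Nat.card G : B)] {I : Ideal B} {z : A ⊗[B] I} (hz : ∀ g : G, g • z = z)
    (h0 : I.subtype.lTensor A z = 0) : z = 0 := by
  obtain ⟨y, hy⟩ := exists_rTensor_reynolds_eq_one_tmul (G := G) z
  rw [rTensor_reynolds_eq_self hz] at hy
  have h : algebraMap B A (y : B) = 0 := by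
    have := congrArg (TensorProduct.rid B A) h0
    rwa [hy, LinearMap.lTensor_tmul, TensorProduct.rid_tmul, map_zero,
      ← Algebra.algebraMap_eq_smul_one] at this
  rw [map_eq_zero_iff _ (FaithfulSMul.algebraMap_injective B A),
    ZeroMemClass.coe_eq_zero] at h
  rw [hy, h, tmul_zero]

/-- The kernel of `A ⊗ I → A` is stable under the divided differences `Δ s`, so by induction on
the number of them needed to annihilate an element, it consists of invariants. -/
theorem flat_of_sub_smul_eq_mul [FaithfulSMul B A] [Finite G] [Invertible (Nat.card G : B)]
    {S : Set G} (hS : Subgroup.closure S = ⊤) {α : S → A} {Δ : S → Module.End B A}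
    (hα : ∀ (s : S) (a : A), a - (s : G) • a = α s * Δ s a)
    (hΔ : ∀ a, ∃ d, a ∈ iteratedKer Δ d) : Module.Flat B A := by
  refine Module.Flat.iff_lTensor_injective'.2 fun I =>
    (injective_iff_map_eq_zero _).2 fun z h0 => ?_
  have hαI (s : S) (z : A ⊗[B] I) : z - (s : G) • z = α s • (Δ s).rTensor I z := by
    induction z with
    | zero => simp
    | add z w hz hw => rw [smul_add, map_add, smul_add, ← hz, ← hw, add_sub_add_comm]
    | tmul a y => rw [smul_tmul', ← sub_tmul, hα, LinearMap.rTensor_tmul, smul_tmul', smul_eq_mul]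
  obtain ⟨d, hd⟩ := exists_mem_iteratedKer_rTensor hΔ I z
  induction d generalizing z with
  | zero => exact (Submodule.mem_bot B).1 hd
  | succ d ih =>
    have hΔz (s : S) : (Δ s).rTensor I z = 0 := by
      refine ih _ ?_ (mem_iteratedKer_succ.1 hd s)
      rw [← LinearMap.comp_apply, LinearMap.lTensor_comp_rTensor, ← LinearMap.rTensor_comp_lTensor,
        LinearMap.comp_apply, h0, map_zero]
    have hstab : Subgroup.closure S ≤ MulAction.stabilizer G z :=
      (Subgroup.closure_le _).2 fun s hs =>
        (sub_eq_zero.1 ((hαI ⟨s, hs⟩ z).trans (by rw [hΔz, smul_zero]))).symm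
    exact eq_zero_of_smul_eq_of_lTensor_subtype_eq_zero
      (fun g => hstab (hS ▸ Subgroup.mem_top g)) h0

end Flatness

theorem exists_linearMap_eq_mul {B A M : Type*} [CommRing B] [CommRing A] [IsDomain A] [Algebra B A]
    [AddCommGroup M] [Module B M] {f : M →ₗ[B] A} {α : A} (hα : α ≠ 0) (h : ∀ x, α ∣ f x) :
    ∃ q : M →ₗ[B] A, ∀ x, f x = α * q x := by
  choose q hq using h
  refine ⟨⟨⟨q, fun x y => mul_left_cancel₀ hα ?_⟩, fun b x => mul_left_cancel₀ hα ?_⟩, hq⟩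
  · rw [← hq, map_add, hq, hq, mul_add]
  · rw [← hq, map_smul, hq, RingHom.id_apply, mul_smul_comm]

section Reflections

variable {V : Type} [AddCommGroup V] [Module ℂ V]

theorem exists_smul_eq_of_ker_le_ker {K E : Type*} [Field K] [AddCommGroup E] [Module K E]
    {f g : Module.Dual K E} (h : LinearMap.ker f ≤ LinearMap.ker g) : ∃ c : K, c • f = g := by
  have : g ∈ Submodule.span K (Set.range fun _ : Unit => f) :=
    mem_span_of_iInf_ker_le_ker (by rwa [iInf_const])
  rwa [Set.range_const, Submodule.mem_span_singleton] at this

theorem exists_ker_eq_of_isCoatom {K E : Type*} [Field K] [AddCommGroup E] [Module K E]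
    {X : Submodule K E} (hX : IsCoatom X) : ∃ α : Module.Dual K E, α ≠ 0 ∧ LinearMap.ker α = X := by
  obtain ⟨α, hα, hle⟩ := Submodule.exists_le_ker_of_lt_top X hX.lt_top
  exact ⟨α, hα, (hX.le_iff_eq fun h => hα (LinearMap.ker_eq_top.1 h)).1 hle⟩

theorem ι_dvd_sub_smul {r : V ≃ₗ[ℂ] V} {α : Module.Dual ℂ V} (hα : LinearMap.ker α ≤ fixedSpace r)
    (a : Coord V) : ι ℂ _ α ∣ a - r • a := by
  let π := Ideal.Quotient.mkₐ ℂ (Ideal.span {ι ℂ _ α})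
  suffices π.comp (coordHom r) = π by
    rw [← Ideal.mem_span_singleton, ← Ideal.Quotient.eq]
    exact (DFunLike.congr_fun this a).symm
  ext ξ
  obtain ⟨c, hc⟩ := exists_smul_eq_of_ker_le_ker (f := α)
    (g := ((r⁻¹ : V ≃ₗ[ℂ] V) : V →ₗ[ℂ] V).dualMap ξ - ξ) fun x hx => by
      have hrx : (r⁻¹ : V ≃ₗ[ℂ] V) x = x := r.symm_apply_eq.2 (hα hx).symm
      simp [hrx]
  have h := congrArg (ι ℂ (Module.Dual ℂ V)) hc
  rw [map_smul, map_sub, ← coordHom_ι] at h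
  exact Ideal.Quotient.eq.2 (h ▸ Submodule.smul_of_tower_mem _ c (Ideal.mem_span_singleton_self _))

end Reflections

section FlatInvariants

variable {V : Type} [AddCommGroup V] [Module ℂ V] [FiniteDimensional ℂ V]
  {W : Subgroup (V ≃ₗ[ℂ] V)}

theorem exists_dividedDifference {r : W} (hr : IsReflection (r : V ≃ₗ[ℂ] V)) :
    ∃ (α : Coord V) (Δ : Module.End (Invariants W) (Coord V)),
      (∀ a, a - r • a = α * Δ a) ∧ ∀ a, Δ a ≠ 0 → degree (Δ a) < degree a := by
  obtain ⟨α, hα, hker⟩ := exists_ker_eq_of_isCoatom hr.2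
  have hα0 : ι ℂ _ α ≠ 0 := (map_ne_zero_iff _ ι_injective).2 hα
  obtain ⟨Δ, hΔ⟩ := exists_linearMap_eq_mul (B := Invariants W)
    (f := LinearMap.id - DistribSMul.toLinearMap (Invariants W) (Coord V) r) hα0
    fun a => ι_dvd_sub_smul hker.le a
  refine ⟨ι ℂ _ α, Δ, hΔ, fun a ha => ?_⟩
  have h : degree (Δ a) + 1 ≤ max (degree a) (degree (r • a)) := by
    rw [← degree_ι hα, add_comm, ← degree_mul hα0 ha, ← hΔ]
    exact degree_sub_le _ _
  exact h.trans (max_le le_rfl (degree_smul_le (r : V ≃ₗ[ℂ] V) a))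

omit [FiniteDimensional ℂ V] in
theorem IsReflectionGroup.closure_reflections (hW : IsReflectionGroup W) :
    Subgroup.closure {r : W | IsReflection (r : V ≃ₗ[ℂ] V)} = ⊤ := by
  rw [← Subgroup.map_injective W.subtype_injective |>.eq_iff, MonoidHom.map_closure]
  convert hW.closure_eq using 2
  · ext r
    simp [and_comm]
  · simp [← MonoidHom.range_eq_map]

theorem IsReflectionGroup.flat_invariants (hW : IsReflectionGroup W) :
    Module.Flat (Invariants W) (Coord V) := by
  have := hW.finite
  have hcard : IsUnit (Nat.card W : ℂ) := IsUnit.mk0 _ (Nat.cast_ne_zero.2 Nat.card_pos.ne')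
  have : Invertible (Nat.card W : Invariants W) :=
    IsUnit.invertible (by simpa using hcard.map (algebraMap ℂ (Invariants W)))
  choose α Δ hα hΔ using fun r : {r : W | IsReflection (r : V ≃ₗ[ℂ] V)} =>
    exists_dividedDifference r.2
  exact flat_of_sub_smul_eq_mul hW.closure_reflections hα fun a =>
    ⟨degree a + 1, mem_iteratedKer_of_lt hΔ (Nat.lt_succ_self _)⟩

end FlatInvariants

/-! ### Graphs of group elements -/

theorem exists_eq_smul_of_smul_eq_smul {A M : Type*} [CommRing A] [AddCommGroup M] [Module A M]
    [Module.Flat A M] {p d : A} (hp : Prime p) (hd : ¬ p ∣ d) {m m' : M} (h : d • m = p • m') :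
    ∃ m'', m = p • m'' := by
  let e := TensorProduct.tensorQuotEquivQuotSMul M (Ideal.span {p})
  have hreg : IsSMulRegular (A ⧸ Ideal.span {p}) d := by
    refine (isSMulRegular_quotient_iff_mem_of_smul_mem _ _).2 fun x hx => ?_
    rw [Ideal.mem_span_singleton] at hx ⊢
    exact (hp.dvd_or_dvd hx).resolve_left hd
  have hm := mem_of_isSMulRegular_quotient_of_smul_mem
    ((e.isSMulRegular_congr d).1 (hreg.lTensor M)) (x := m) <| by
      rw [h]
      exact Submodule.smul_mem_smul (Ideal.mem_span_singleton_self p) trivial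
  rw [Submodule.ideal_span_singleton_smul, Submodule.mem_smul_pointwise_iff_exists] at hm
  obtain ⟨m'', -, hm''⟩ := hm
  exact ⟨m'', hm''.symm⟩

theorem exists_smul_mem_forall_prime_dvd {A Q : Type*} [CommRing A] [IsDomain A] [WfDvdMonoid A]
    [AddCommGroup Q] [Module A Q] [Module.IsTorsionFree A Q] {M : Submodule A Q} [Module.Flat A M]
    {e : Q} (he : ∃ d : A, d ≠ 0 ∧ d • e ∈ M) :
    ∃ d : A, d ≠ 0 ∧ d • e ∈ M ∧ ∀ p, Prime p → p ∣ d → ∀ d' : A, d' • e ∈ M → p ∣ d' := by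
  obtain ⟨d, ⟨hd, hde⟩, hmin⟩ :=
    (IsWellFounded.wf : WellFounded (DvdNotUnit (α := A))).has_min {d | d ≠ 0 ∧ d • e ∈ M} he
  refine ⟨d, hd, hde, fun p hp ⟨c, hc⟩ d' hd' => ?_⟩
  have hc0 : c ≠ 0 := right_ne_zero_of_mul (hc ▸ hd)
  by_contra hpd'
  obtain ⟨m, hm⟩ := exists_eq_smul_of_smul_eq_smul (m := (⟨d • e, hde⟩ : M))
    (m' := c • (⟨d' • e, hd'⟩ : M)) hp hpd' (Subtype.ext (by
      simp only [SetLike.mk_smul_mk, smul_smul, hc]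
      ring_nf))
  have hce : c • e = m := smul_right_injective Q hp.ne_zero (by
    simpa [hc, mul_smul] using congrArg Subtype.val hm)
  exact hmin c ⟨hc0, hce ▸ m.2⟩ ⟨hc0, p, hp.not_isUnit, by rw [hc, mul_comm]⟩

section Graphs

open TensorProduct

variable (B A G : Type*) [CommRing B] [CommRing A] [Algebra B A] [Group G]
  [MulSemiringAction G A] [SMulCommClass G B A]

/-- The restriction of functions on `Spec A ×_{Spec B} Spec A` to the union of the graphs of the
elements of `G`, where the graph of `g` is parametrized by its first factor. -/
def restrictGraphs : A ⊗[B] A →ₐ[A] (G → A) :=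
  Algebra.TensorProduct.lift (Algebra.ofId A (G → A))
    (AlgHom.pi fun g => MulSemiringAction.toAlgHom B A g) fun _ _ => Commute.all _ _

variable {B A G}

@[simp]
theorem restrictGraphs_tmul (a b : A) (g : G) : restrictGraphs B A G (a ⊗ₜ b) g = a * g • b := by
  simp [restrictGraphs, Algebra.ofId_apply]

theorem eq_zero_of_forall_sum_smul_mul_eq_zero [IsDomain A] [FaithfulSMul G A] [Fintype G] {a : A}
    (h : ∀ t, ∑ g : G, g • (t * a) = 0) : a = 0 := by
  have hinj : Function.Injective fun g : G => (MulSemiringAction.toRingHom G A g : A →* A) :=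
    fun g k hgk => FaithfulSMul.eq_of_smul_eq_smul fun b => DFunLike.congr_fun hgk b
  have := Fintype.linearIndependent_iff.1 ((linearIndependent_monoidHom A A).comp _ hinj)
    (fun g => g • a) (funext fun t => by simpa [mul_comm] using h t) 1
  simpa using this

variable (B A G) in
/-- The functions on the disjoint union of the graphs of the elements of `G` which descend to
functions on `Spec A ×_{Spec B} Spec A`. -/
def graphFunctions : Submodule A (G → A) := LinearMap.range (restrictGraphs B A G).toLinearMap

theorem exists_smul_indicator_mem_graphFunctions [Finite G] {k : Type*} [CommRing k] [IsDomain k]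
    (φ : A →+* k) {N : Subgroup G}
    (h : ∀ u ∉ N, ∃ c : A, (∀ n ∈ N, n • c = c) ∧ φ c ≠ φ (u • c)) :
    ∃ d : A, d • Set.indicator N 1 ∈ graphFunctions B A G ∧ φ d ≠ 0 := by
  classical
  have := Fintype.ofFinite G
  choose! c hcN hc using h
  refine ⟨∏ u with u ∉ N, (c u - u • c u),
    ⟨∏ u with u ∉ N, (1 ⊗ₜ c u - (u • c u) ⊗ₜ 1), funext fun g => ?_⟩, ?_⟩
  · rw [AlgHom.toLinearMap_apply, map_prod, Finset.prod_apply]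
    simp only [map_sub, Pi.sub_apply, restrictGraphs_tmul, one_mul, smul_one, mul_one,
      Pi.smul_apply, smul_eq_mul]
    by_cases hg : g ∈ N
    · rw [Set.indicator_of_mem (by simpa), Pi.one_apply, mul_one]
      exact Finset.prod_congr rfl fun u hu => by rw [hcN u (by simpa using hu) g hg]
    · rw [Set.indicator_of_notMem (by simpa), mul_zero]
      exact Finset.prod_eq_zero (i := g) (by simpa) (sub_self _)
  · rw [map_prod, Finset.prod_ne_zero_iff]
    refine fun u hu => ?_
    rw [map_sub]
    exact sub_ne_zero.2 (hc u (by simpa using hu))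

variable [Algebra.IsInvariant B A G]

theorem exists_trace [FaithfulSMul B A] [Fintype G] :
    ∃ τ : A →ₗ[B] B, ∀ a, algebraMap B A (τ a) = ∑ g : G, g • a := by
  choose τ hτ using fun a : A => Algebra.IsInvariant.isInvariant (A := B) (G := G) (∑ g : G, g • a)
    fun k => smul_sum_smul k a
  have hinj := FaithfulSMul.algebraMap_injective B A
  refine ⟨⟨⟨τ, fun a b => hinj ?_⟩, fun b a => hinj ?_⟩, hτ⟩
  · simp [hτ, Finset.sum_add_distrib]
  · simp [hτ, Algebra.smul_def, Finset.mul_sum, smul_mul']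

theorem restrictGraphs_injective [IsDomain A] [FaithfulSMul B A] [FaithfulSMul G A] [Finite G]
    [Module.Finite B A] [Module.Flat B A] : Function.Injective (restrictGraphs B A G) := by
  classical
  have := Fintype.ofFinite G
  obtain ⟨τ, hτ⟩ := exists_trace (B := B) (A := A) (G := G)
  obtain ⟨S, hS⟩ := Module.Finite.fg_top (R := B) (M := A)
  -- The trace form embeds `A` into `B ^ S`, hence `A ⊗ A` into `A ^ S` by flatness.
  let f : A →ₗ[B] S → B := LinearMap.pi fun t => τ ∘ₗ LinearMap.mulLeft B t.1
  have hf : Function.Injective f := by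
    refine (injective_iff_map_eq_zero f).2 fun a ha => eq_zero_of_forall_sum_smul_mul_eq_zero
      (G := G) fun t => ?_
    have : τ ∘ₗ LinearMap.mulRight B a = 0 :=
      LinearMap.ext_on hS fun t ht => congrFun ha ⟨t, ht⟩
    rw [← hτ]
    exact congrArg _ (LinearMap.congr_fun this t) |>.trans (map_zero _)
  have hflat := Module.Flat.lTensor_preserves_injective_linearMap (M := A) f hf
  have htrace (z : A ⊗[B] A) (t : S) :
      piScalarRight B B A S (f.lTensor A z) t =
        ∑ g : G, g • t.1 * restrictGraphs B A G z g := by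
    induction z with
    | zero => simp
    | add y z hy hz => simp only [map_add, Pi.add_apply, hy, hz, mul_add, Finset.sum_add_distrib]
    | tmul a b =>
      simp only [f, piScalarRight_apply, LinearMap.lTensor_tmul, piScalarRightHom_tmul,
        LinearMap.pi_apply, LinearMap.comp_apply, LinearMap.mulLeft_apply, Algebra.smul_def, hτ,
        Finset.sum_mul, restrictGraphs_tmul, smul_mul']
      exact Finset.sum_congr rfl fun g _ => by ring
  refine (injective_iff_map_eq_zero _).2 fun z hz => hflat ?_
  rw [map_zero, ← (piScalarRight B B A S).map_eq_zero_iff]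
  exact funext fun t => by simp [htrace, hz]

theorem flat_graphFunctions [IsDomain A] [FaithfulSMul B A] [FaithfulSMul G A] [Finite G]
    [Module.Finite B A] [Module.Flat B A] : Module.Flat A (graphFunctions B A G) :=
  Module.Flat.of_linearEquiv (LinearEquiv.ofInjective _ restrictGraphs_injective).symm

end Graphs

/-! ### Point stabilizers in reflection groups -/

section Stabilizers

variable {V : Type} [AddCommGroup V] [Module ℂ V] {W : Subgroup (V ≃ₗ[ℂ] V)}

theorem evalAt_eq_evalAt_one_of_mem_graphFunctions {w : W} {v : V} (hw : w • v = v)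
    {F : W → Coord V} (hF : F ∈ graphFunctions (Invariants W) (Coord V) W) :
    evalAt v (F w) = evalAt v (F 1) := by
  obtain ⟨z, rfl⟩ := hF
  simp only [AlgHom.toLinearMap_apply]
  induction z with
  | zero => simp
  | add y z hy hz => simp only [map_add, Pi.add_apply, hy, hz]
  | tmul a b => simp [evalAt_smul, inv_smul_eq_iff.2 hw.symm]

theorem fixedSpace_lt_top {g : V ≃ₗ[ℂ] V} (hg : g ≠ 1) : fixedSpace g < ⊤ :=
  lt_top_iff_ne_top.2 fun h => hg (LinearEquiv.ext fun x =>
    (h ▸ Submodule.mem_top : x ∈ fixedSpace g))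

variable [FiniteDimensional ℂ V]

instance [Finite W] : Module.Finite (Invariants W) (Coord V) := by
  have : Algebra.IsIntegral (Invariants W) (Coord V) :=
    Algebra.IsInvariant.isIntegral (Invariants W) (Coord V) W
  have : Algebra.FiniteType (Invariants W) (Coord V) :=
    Algebra.FiniteType.of_restrictScalars_finiteType ℂ _ _
  exact Algebra.IsIntegral.finite

theorem exists_smul_eq_of_forall_evalAt_eq [Finite W] {N : Subgroup W} {x y : V}
    (h : ∀ a : Coord V, (∀ n ∈ N, n • a = a) → evalAt x a = evalAt y a) :
    ∃ n ∈ N, n • x = y := by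
  classical
  have := Fintype.ofFinite N
  by_contra! hxy
  obtain ⟨a, hxa, hya⟩ := exists_evalAt_eq_one_of_notMem
    (S := Finset.univ.image fun n : N => (n : W) • y) (x := x) <| by
      simp only [Finset.mem_image, Finset.mem_univ, true_and, not_exists]
      exact fun n hn => hxy _ (N.inv_mem n.2) (inv_smul_eq_iff.2 hn.symm)
  have hx : evalAt x (∏ n : N, n • (1 - a)) = 0 := by
    rw [map_prod]
    exact Finset.prod_eq_zero (Finset.mem_univ 1) (by simp [hxa])
  have hy : evalAt y (∏ n : N, n • (1 - a)) = 1 := by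
    rw [map_prod]
    refine Finset.prod_eq_one fun n _ => ?_
    rw [Subgroup.smul_def, evalAt_smul, map_sub, map_one,
      hya ((n : W)⁻¹ • y) (Finset.mem_image.2 ⟨n⁻¹, Finset.mem_univ _, rfl⟩), sub_zero]
  refine zero_ne_one (hx.symm.trans ((h _ fun n hn => ?_).trans hy))
  exact Finset.smul_prod_perm (1 - a) (⟨n, hn⟩ : N)

theorem isCoatom_and_forall_mem_of_prime_dvd {F : Submodule ℂ V} (hF : F < ⊤) {p : Coord V}
    (hp : Prime p) (h : ∀ η : Module.Dual ℂ V, F ≤ LinearMap.ker η → p ∣ ι ℂ _ η) :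
    IsCoatom F ∧ ∀ v, evalAt v p = 0 → v ∈ F := by
  obtain ⟨α, hα, hFα⟩ := Submodule.exists_le_ker_of_lt_top F hF
  have hpα : Associated p (ι ℂ _ α) :=
    (hp.irreducible.dvd_irreducible_iff_associated (prime_ι hα).irreducible).1 (h α hFα)
  have hker : LinearMap.ker α = F := by
    refine le_antisymm (fun v hv => ?_) hFα
    by_contra hvF
    obtain ⟨η, hηv, hFη⟩ := Submodule.exists_le_ker_of_notMem hvF
    obtain ⟨c, hc⟩ := hpα.symm.dvd.trans (h η hFη)
    refine hηv ?_
    rw [← evalAt_ι, hc, map_mul, evalAt_ι, LinearMap.mem_ker.1 hv, zero_mul]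
  refine ⟨hker ▸ LinearMap.isCoatom_ker_of_surjective (LinearMap.surjective hα), fun v hv => ?_⟩
  obtain ⟨c, hc⟩ := h α hFα
  rw [← hker, LinearMap.mem_ker, ← evalAt_ι, hc, map_mul, hv, zero_mul]

theorem exists_stabilizer_le_of_forall_notMem [Finite W] {N : Subgroup W} {P : Ideal (Coord V)}
    [P.IsPrime] (h : ∀ w : W, w ∉ N → ∃ η : Module.Dual ℂ V,
      fixedSpace (w : V ≃ₗ[ℂ] V) ≤ LinearMap.ker η ∧ ι ℂ _ η ∉ P) :
    ∃ x, (∀ p ∈ P, evalAt x p = 0) ∧ MulAction.stabilizer W x ≤ N := by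
  classical
  have := Fintype.ofFinite W
  choose! η hη hηP using h
  have hprod : ∏ w with w ∉ N, ι ℂ _ (η w) ∉ P := fun hmem => by
    obtain ⟨w, hw, hwP⟩ := (Ideal.IsPrime.prod_mem_iff).1 hmem
    exact hηP w (by simpa using hw) hwP
  obtain ⟨x, hxP, hx⟩ : ∃ x, (∀ p ∈ P, evalAt x p = 0) ∧
      evalAt x (∏ w with w ∉ N, ι ℂ _ (η w)) ≠ 0 := by
    by_contra! hall
    exact hprod (mem_of_forall_evalAt_eq_zero hall)
  refine ⟨x, hxP, fun w hw => ?_⟩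
  by_contra hwN
  rw [map_prod, Finset.prod_ne_zero_iff] at hx
  exact hx w (by simpa using hwN) ((evalAt_ι _ _).trans (hη w hwN hw))

theorem exists_notMem_smul_indicator_mem_graphFunctions [Finite W] {N : Subgroup W}
    {P : Ideal (Coord V)} [P.IsPrime] (h : ∀ w : W, w ∉ N → ∃ η : Module.Dual ℂ V,
      fixedSpace (w : V ≃ₗ[ℂ] V) ≤ LinearMap.ker η ∧ ι ℂ _ η ∉ P) :
    ∃ d ∉ P, d • Set.indicator N 1 ∈ graphFunctions (Invariants W) (Coord V) W := by
  obtain ⟨x, hxP, hx⟩ := exists_stabilizer_le_of_forall_notMem h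
  obtain ⟨d, hdN, hd⟩ := exists_smul_indicator_mem_graphFunctions (B := Invariants W)
    (evalAt x : Coord V →+* ℂ) (N := N) fun u hu => by
      by_contra! hc
      obtain ⟨n, hn, hnx⟩ := exists_smul_eq_of_forall_evalAt_eq (y := u⁻¹ • x) fun a ha =>
        (hc a ha).trans (evalAt_smul u x a)
      have : u * n ∈ N := hx (by rw [MulAction.mem_stabilizer_iff, mul_smul, hnx, smul_inv_smul])
      exact hu ((N.mul_mem_cancel_right hn).1 this)
  exact ⟨d, fun hdP => hd (hxP d hdP), hdN⟩

theorem exists_prime_dvd_evalAt_eq_zero {d : Coord V} (hd : d ≠ 0) {v : V}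
    (hv : evalAt v d = 0) : ∃ p, Prime p ∧ p ∣ d ∧ evalAt v p = 0 := by
  obtain ⟨f, hf, hfd⟩ := UniqueFactorizationMonoid.exists_prime_factors d hd
  have hfv : f.prod ∈ RingHom.ker (evalAt v) :=
    (Ideal.mem_iff_of_associated hfd).2 (RingHom.mem_ker.2 hv)
  obtain ⟨p, hpf, hpv⟩ :=
    ((RingHom.ker_isPrime (evalAt v)).multiset_prod_mem_iff_exists_mem f).1 hfv
  exact ⟨p, hf p hpf, (Multiset.dvd_prod hpf).trans hfd.dvd, hpv⟩

/-- The indicator function of `N` has a denominator `d` all of whose prime factors divide every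
other denominator. The fixed space of an element outside `N` has codimension at least two or is a
mirror not containing `v`, so there is a denominator not divisible by a given prime that vanishes at
`v`. Hence `d` does not vanish at `v`, while a function on `V ×_{V/W} V` takes the same value at
`(v, v)` on all graphs of elements of the stabilizer. -/
theorem IsReflectionGroup.stabilizer_le (hW : IsReflectionGroup W) {N : Subgroup W} {v : V}
    (hN : ∀ r : W, IsReflection (r : V ≃ₗ[ℂ] V) → r • v = v → r ∈ N) :
    MulAction.stabilizer W v ≤ N := by
  have := hW.finite
  have := hW.flat_invariants
  have := flat_graphFunctions (B := Invariants W) (A := Coord V) (G := W)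
  have hlt {w : W} (hw : w ∉ N) : fixedSpace (w : V ≃ₗ[ℂ] V) < ⊤ :=
    fixedSpace_lt_top fun h => hw ((Subtype.ext h : w = 1) ▸ N.one_mem)
  have hI : ∃ d : Coord V, d ≠ 0 ∧
      d • Set.indicator N 1 ∈ graphFunctions (Invariants W) (Coord V) W :=
    exists_notMem_smul_indicator_mem_graphFunctions (P := ⊥) fun w hw => by
      obtain ⟨η, hη, hle⟩ := Submodule.exists_le_ker_of_lt_top _ (hlt hw)
      exact ⟨η, hle, (map_ne_zero_iff _ ι_injective).2 hη⟩
  obtain ⟨d, hd, hdN, hdvd⟩ := exists_smul_mem_forall_prime_dvd hI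
  have hdv : evalAt v d ≠ 0 := fun hdv => by
    obtain ⟨p, hp, hpd, hpv⟩ := exists_prime_dvd_evalAt_eq_zero hd hdv
    have := (Ideal.span_singleton_prime hp.ne_zero).2 hp
    obtain ⟨d', hd', hd'N⟩ :=
      exists_notMem_smul_indicator_mem_graphFunctions (N := N) (P := Ideal.span {p}) fun w hw => by
        by_contra! h
        obtain ⟨hco, hmem⟩ := isCoatom_and_forall_mem_of_prime_dvd (hlt hw) hp fun η hη =>
          Ideal.mem_span_singleton.1 (h η hη)
        exact hw (hN w ⟨W.subtype.isOfFinOrder (isOfFinOrder_of_finite w), hco⟩ (hmem v hpv))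
    exact hd' (Ideal.mem_span_singleton.2 (hdvd p hp hpd d' hd'N))
  intro w hw
  by_contra hwN
  have h := evalAt_eq_evalAt_one_of_mem_graphFunctions hw hdN
  simp [hwN, N.one_mem, hdv.symm] at h

end Stabilizers

/-! ### Frobenius reciprocity -/

section Induction

variable {G A R : Type} [Group G] {H : Subgroup G} [CommRing A] [Algebra ℂ A]
  [MulSemiringAction G A] [SMulCommClass G ℂ A] [CommRing R] [Algebra ℂ R]
  {β : H →* (R ≃ₐ[ℂ] R)} {f : A →ₐ[ℂ] R} (hf : ∀ (h : H) a, f (h • a) = β h (f a))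

/-- The `G`-equivariant homomorphism from `A` to the functions on `G ×_H Spec R` which corresponds
to an `H`-equivariant homomorphism from `A` to `R`. -/
def toInduced : A →ₐ[ℂ] inducedAlgebra β :=
  AlgHom.codRestrict
    (AlgHom.pi fun g : G => f.comp (MulSemiringAction.toAlgHom ℂ A g⁻¹)) _
    fun a h g => by
      simp only [AlgHom.pi_apply, AlgHom.comp_apply, MulSemiringAction.toAlgHom_apply]
      rw [mul_inv_rev, inv_inv, mul_smul]
      exact hf h _

theorem toInduced_apply (a : A) (g : G) : (toInduced hf a).1 g = f (g⁻¹ • a) := rfl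

theorem inducedAut_toInduced (g : G) (a : A) :
    inducedAut β g (toInduced hf a) = toInduced hf (g • a) := by
  refine Subtype.ext (funext fun x => ?_)
  change (toInduced hf a).1 (g⁻¹ * x) = _
  rw [toInduced_apply, toInduced_apply, mul_inv_rev, inv_inv, mul_smul]

theorem toInduced_surjective [Finite G] (hsurj : Function.Surjective f) {e : A}
    (he : ∀ g ∈ H, f (g • e) = 1) (he' : ∀ g ∉ H, f (g • e) = 0) :
    Function.Surjective (toInduced hf) := by
  classical
  have := Fintype.ofFinite G
  rintro ⟨F, hF⟩
  choose a ha using fun g => hsurj (F g)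
  have hterm (g k : G) : f (k⁻¹ • (g • e * g • a g)) = if k⁻¹ * g ∈ H then F k else 0 := by
    rw [smul_mul', map_mul, ← mul_smul, ← mul_smul]
    split_ifs with h
    · rw [he _ h, one_mul]
      have hk := hF ⟨_, h⟩ g
      rw [mul_inv_rev, inv_inv, mul_inv_cancel_left, ← ha g, ← hf] at hk
      exact hk.symm
    · rw [he' _ h, zero_mul]
  have hcard : (Fintype.card H : ℂ) ≠ 0 := Nat.cast_ne_zero.2 Fintype.card_ne_zero
  refine ⟨(Fintype.card H : ℂ)⁻¹ • ∑ g, g • e * g • a g, Subtype.ext (funext fun k => ?_)⟩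
  rw [map_smul, SetLike.val_smul, Pi.smul_apply, inv_smul_eq_iff₀ hcard, toInduced_apply,
    Finset.smul_sum, map_sum, Nat.cast_smul_eq_nsmul ℂ]
  simp only [hterm]
  rw [← Finset.sum_filter, Finset.sum_const, Fintype.card_subtype]
  exact congrArg (· • F k) (Finset.card_equiv (Equiv.mulLeft k⁻¹) (by simp))

end Induction

/-! ### Fibres of the quotient map -/

section Fibre

variable {V : Type} [AddCommGroup V] [Module ℂ V] {W : Subgroup (V ≃ₗ[ℂ] V)} {H : Subgroup W}
  {v : V}

/-- The ideal of the fibre of `V → V/H` through `v`. -/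
def fibreIdeal (H : Subgroup W) (v : V) : Ideal (Coord V) :=
  Ideal.span {a | (∀ h : H, h • a = a) ∧ evalAt v a = 0}

theorem fibreIdeal_anti {K : Subgroup W} (h : H ≤ K) (v : V) : fibreIdeal K v ≤ fibreIdeal H v :=
  Ideal.span_mono fun _ ha => ⟨fun x => ha.1 ⟨x, h x.2⟩, ha.2⟩

theorem fibreIdeal_zero (H : Subgroup W) : fibreIdeal H 0 = coinvariantIdeal H := by
  rw [fibreIdeal, coinvariantIdeal, evalAt_zero]

theorem smul_mem_fibreIdeal_top (w : W) {a : Coord V} (ha : a ∈ fibreIdeal (⊤ : Subgroup W) v) :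
    w • a ∈ fibreIdeal (⊤ : Subgroup W) v := by
  induction ha using Submodule.span_induction with
  | mem x hx =>
    have hwx : w • x = x := hx.1 ⟨w, trivial⟩
    rw [hwx]
    exact Ideal.subset_span hx
  | zero => rw [smul_zero]; exact zero_mem _
  | add x y _ _ hx hy => rw [smul_add]; exact add_mem hx hy
  | smul r x _ hx => rw [smul_eq_mul, smul_mul']; exact Ideal.mul_mem_left _ _ hx

theorem translate_mem_fibreIdeal (hv : H ≤ MulAction.stabilizer W v) {x : V} {a : Coord V}
    (ha : a ∈ fibreIdeal H (x + v)) : translate v a ∈ fibreIdeal H x := by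
  refine (Ideal.span_le (I := (fibreIdeal H x).comap (translate v))).2 (fun b hb => ?_) ha
  refine Ideal.subset_span ⟨fun h => ?_, by rw [evalAt_translate, hb.2]⟩
  rw [Subgroup.smul_def, ← translate_smul (hv h.2), ← Subgroup.smul_def, hb.1 h]

theorem translate_mem_coinvariantIdeal_iff (hv : H ≤ MulAction.stabilizer W v) {a : Coord V} :
    translate v a ∈ coinvariantIdeal H ↔ a ∈ fibreIdeal H v := by
  rw [← fibreIdeal_zero]
  refine ⟨fun ha => ?_, fun ha => translate_mem_fibreIdeal hv (by rwa [zero_add])⟩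
  have hv' : H ≤ MulAction.stabilizer W (-v) := fun h hh =>
    (smul_neg h v).trans (congrArg Neg.neg (hv hh))
  rw [← add_neg_cancel v] at ha
  simpa [translate_translate, translate_zero] using translate_mem_fibreIdeal hv' ha

theorem sub_algebraMap_mem_fibreIdeal {a : Coord V} (ha : ∀ h : H, h • a = a) (v : V) :
    a - algebraMap ℂ _ (evalAt v a) ∈ fibreIdeal H v :=
  Ideal.subset_span ⟨fun h => by rw [smul_sub, ha, smul_algebraMap], by simp⟩

theorem mem_fibreIdeal_of_mul_mem {a s : Coord V} (hs : ∀ h : H, h • s = s) (hsv : evalAt v s ≠ 0)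
    (h : s * a ∈ fibreIdeal H v) : a ∈ fibreIdeal H v := by
  have hc := sub_mem h (Ideal.mul_mem_right a _ (sub_algebraMap_mem_fibreIdeal hs v))
  rw [← sub_mul, sub_sub_cancel, ← Algebra.smul_def] at hc
  simpa [hsv] using Submodule.smul_of_tower_mem (fibreIdeal H v) (evalAt v s)⁻¹ hc

theorem mem_radical_fibreIdeal [FiniteDimensional ℂ V] [Finite W] {a : Coord V}
    (ha : ∀ w : W, evalAt (w • v) a = 0) : a ∈ (fibreIdeal (⊤ : Subgroup W) v).radical := by
  rw [Ideal.radical_eq_sInf, Submodule.mem_sInf]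
  rintro P ⟨hP, hprime⟩
  refine mem_of_forall_evalAt_eq_zero fun x hx => ?_
  obtain ⟨w, -, rfl⟩ := exists_smul_eq_of_forall_evalAt_eq (N := (⊤ : Subgroup W)) (x := v) (y := x)
    fun b hb => by
      have hinv (h : (⊤ : Subgroup W)) : h • b = b := hb h trivial
      have hbv := sub_algebraMap_mem_fibreIdeal hinv v
      have hbx := hx _ (hP hbv)
      rw [map_sub, AlgHom.commutes, sub_eq_zero] at hbx
      exact hbx.symm
  exact ha w

variable (W v) in
/-- A polynomial function which modulo the ideal of the fibre of `V → V/W` through `v` behaves like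
the idempotent with value `1` at `v` and `0` at the other points of the orbit. -/
structure IsLocalizer (p : Coord V) : Prop where
  smul_eq : ∀ h : MulAction.stabilizer W v, h • p = p
  evalAt_eq_one : evalAt v p = 1
  evalAt_smul_eq_zero : ∀ w ∉ MulAction.stabilizer W v, evalAt v (w • p) = 0
  mul_smul_mem : ∀ w ∉ MulAction.stabilizer W v, p * w • p ∈ fibreIdeal (⊤ : Subgroup W) v

variable (W v) in
theorem exists_isLocalizer [FiniteDimensional ℂ V] [Finite W] : ∃ p, IsLocalizer W v p := by
  classical
  have := Fintype.ofFinite W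
  obtain ⟨a, ha, ha'⟩ := exists_evalAt_eq_one_of_notMem
    (S := (Finset.univ.image fun w : W => w • v).erase v) (Finset.notMem_erase v _)
  let q : Coord V := ∏ h : MulAction.stabilizer W v, h • a
  have hq (h : MulAction.stabilizer W v) : h • q = q :=
    Finset.smul_prod_perm a h
  have hqv : evalAt v q = 1 := by
    rw [map_prod]
    exact Finset.prod_eq_one fun h _ => by
      rw [Subgroup.smul_def, evalAt_smul, MulAction.mem_stabilizer_iff.1 (inv_mem h.2), ha]
  have hqw {w : W} (hw : w ∉ MulAction.stabilizer W v) : evalAt v (w • q) = 0 := by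
    rw [evalAt_smul, map_prod]
    refine Finset.prod_eq_zero (Finset.mem_univ 1) ?_
    rw [one_smul]
    exact ha' (w⁻¹ • v) (Finset.mem_erase.2 ⟨fun h => hw (inv_mem_iff.1 h), by simp⟩)
  have hrad (w : W) (hw : w ∉ MulAction.stabilizer W v) :
      q * w • q ∈ (fibreIdeal (⊤ : Subgroup W) v).radical := by
    refine mem_radical_fibreIdeal fun g => ?_
    by_cases hg : g⁻¹ ∈ MulAction.stabilizer W v
    · rw [map_mul, MulAction.mem_stabilizer_iff.1 (inv_mem_iff.1 hg), hqw hw, mul_zero]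
    · rw [← inv_inv g, ← evalAt_smul, smul_mul', map_mul, hqw hg, zero_mul]
  have : IsNoetherianRing (Coord V) := Algebra.FiniteType.isNoetherianRing ℂ _
  obtain ⟨n, hn⟩ := Ideal.exists_radical_pow_le_of_fg (fibreIdeal (⊤ : Subgroup W) v)
    (IsNoetherian.noetherian _)
  refine ⟨q ^ (n + 1), fun h => by rw [smul_pow', hq], by rw [map_pow, hqv, one_pow],
    fun w hw => by rw [smul_pow', map_pow, hqw hw, zero_pow n.succ_ne_zero], fun w hw => ?_⟩
  rw [smul_pow', ← mul_pow, pow_succ]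
  exact Ideal.mul_mem_right _ _ (hn (Ideal.pow_mem_pow (hrad w hw) n))

theorem IsLocalizer.mul_mul_mem_of_forall_smul_eq [Finite W] {p : Coord V} (hp : IsLocalizer W v p)
    {f : Coord V} (hf : ∀ h : MulAction.stabilizer W v, h • f = f) (hfv : evalAt v f = 0) :
    p * (p * f) ∈ fibreIdeal (⊤ : Subgroup W) v := by
  classical
  have := Fintype.ofFinite W
  have hsum : ∑ w : W, w • (p * f) ∈ fibreIdeal (⊤ : Subgroup W) v := by
    refine Ideal.subset_span ⟨fun w => smul_sum_smul (w : W) _, ?_⟩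
    rw [map_sum]
    refine Finset.sum_eq_zero fun w _ => ?_
    rw [smul_mul', map_mul]
    by_cases hw : w ∈ MulAction.stabilizer W v
    · rw [evalAt_smul w v f, MulAction.mem_stabilizer_iff.1 (inv_mem hw), hfv, mul_zero]
    · rw [hp.evalAt_smul_eq_zero w hw, zero_mul]
  have hmoved : p * ∑ w : W with w ∉ MulAction.stabilizer W v, w • (p * f) ∈
      fibreIdeal (⊤ : Subgroup W) v := by
    rw [Finset.mul_sum]
    refine sum_mem fun w hw => ?_
    rw [smul_mul', ← mul_assoc]
    exact Ideal.mul_mem_right _ _ (hp.mul_smul_mem w (Finset.mem_filter.1 hw).2)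
  have hfixed : ∑ w : W with w ∈ MulAction.stabilizer W v, w • (p * f) =
      Fintype.card (MulAction.stabilizer W v) • (p * f) := by
    rw [Fintype.card_subtype]
    refine Finset.sum_eq_card_nsmul fun w hw => ?_
    have hw := (Finset.mem_filter.1 hw).2
    exact (smul_mul' w p f).trans (congrArg₂ _ (hp.smul_eq ⟨w, hw⟩) (hf ⟨w, hw⟩))
  have hcard := Ideal.mul_mem_left _ p hsum
  rw [← Finset.sum_filter_add_sum_filter_not _ (· ∈ MulAction.stabilizer W v), mul_add,
    Submodule.add_mem_iff_left _ hmoved, hfixed, ← Nat.cast_smul_eq_nsmul ℂ, mul_smul_comm] at hcard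
  exact (Submodule.smul_mem_iff ((fibreIdeal ⊤ v).restrictScalars ℂ)
    (Nat.cast_ne_zero.2 Fintype.card_ne_zero)).1 hcard

theorem IsLocalizer.mul_mul_mem [Finite W] {p : Coord V} (hp : IsLocalizer W v p) {f : Coord V}
    (hf : f ∈ fibreIdeal (MulAction.stabilizer W v) v) :
    p * (p * f) ∈ fibreIdeal (⊤ : Subgroup W) v := by
  refine Submodule.span_induction (fun f hf => hp.mul_mul_mem_of_forall_smul_eq hf.1 hf.2) (by simp)
    (fun x y _ _ hx hy => ?_) (fun r x _ hx => ?_) hf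
  · rw [mul_add, mul_add]
    exact add_mem hx hy
  · rw [smul_eq_mul, mul_left_comm p r, mul_left_comm p r]
    exact Ideal.mul_mem_left _ _ hx

variable (H v) in
/-- The restriction of functions on `V` to `v + Co(H, V)`. -/
def restrictCo : Coord V →ₐ[ℂ] Coinvariants H :=
  (Ideal.Quotient.mkₐ ℂ (coinvariantIdeal H)).comp (translate v)

theorem restrictCo_eq_zero_iff (hv : H ≤ MulAction.stabilizer W v) {a : Coord V} :
    restrictCo H v a = 0 ↔ a ∈ fibreIdeal H v :=
  Ideal.Quotient.eq_zero_iff_mem.trans (translate_mem_coinvariantIdeal_iff hv)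

theorem restrictCo_surjective (H : Subgroup W) (v : V) : Function.Surjective (restrictCo H v) :=
  (Ideal.Quotient.mk_surjective).comp fun a => ⟨translate (-v) a,
    (translate_translate _ _ a).trans (by rw [add_neg_cancel, translate_zero, AlgHom.id_apply])⟩

theorem restrictCo_smul (hv : H ≤ MulAction.stabilizer W v) (h : H) (a : Coord V) :
    restrictCo H v (h • a) = coinvariantsAut H h (restrictCo H v a) :=
  congrArg (Ideal.Quotient.mk (coinvariantIdeal H)) (translate_smul (hv h.2) a)

theorem coinvariantsPoint_restrictCo (H : Subgroup W) (v : V) (a : Coord V) :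
    coinvariantsPoint H (restrictCo H v a) = evalAt v a := by
  change evalZero V (translate v a) = _
  rw [← evalAt_zero, evalAt_translate, zero_add]

/-- The restriction of functions on `V` to `W ×_H (v + Co(H, V))`, for a subgroup `H` of the
stabilizer of `v`. -/
def fibreHom (hv : H ≤ MulAction.stabilizer W v) :
    Coord V →ₐ[ℂ] inducedAlgebra (coinvariantsAut H) :=
  toInduced (restrictCo_smul hv)

theorem fibreHom_surjective [FiniteDimensional ℂ V] [Finite W]
    (hv : H = MulAction.stabilizer W v) : Function.Surjective (fibreHom hv.le) := by
  subst hv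
  obtain ⟨p, hp⟩ := exists_isLocalizer W v
  have hp1 : restrictCo (MulAction.stabilizer W v) v p = 1 := by
    have h := (restrictCo_eq_zero_iff le_rfl).2 (sub_algebraMap_mem_fibreIdeal hp.smul_eq v)
    rwa [hp.evalAt_eq_one, map_one, map_sub, map_one, sub_eq_zero] at h
  refine toInduced_surjective _ (restrictCo_surjective _ v) (e := p) (fun w hw => ?_) fun w hw => ?_
  · exact (congrArg _ (hp.smul_eq ⟨w, hw⟩)).trans hp1
  · have h := (restrictCo_eq_zero_iff le_rfl).2 (fibreIdeal_anti le_top v (hp.mul_smul_mem w hw))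
    rwa [map_mul, hp1, one_mul] at h

theorem fibreHom_eq_zero_of_mem (hv : H ≤ MulAction.stabilizer W v) {a : Coord V}
    (ha : a ∈ fibreIdeal (⊤ : Subgroup W) v) : fibreHom hv a = 0 :=
  Subtype.ext <| funext fun g => (restrictCo_eq_zero_iff hv).2 <|
    fibreIdeal_anti le_top v (smul_mem_fibreIdeal_top g⁻¹ ha)

theorem fibreHom_eq_zero_iff [FiniteDimensional ℂ V] [Finite W]
    (hv : H = MulAction.stabilizer W v) {a : Coord V} :
    fibreHom hv.le a = 0 ↔ a ∈ fibreIdeal (⊤ : Subgroup W) v := by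
  classical
  refine ⟨fun ha => ?_, fibreHom_eq_zero_of_mem hv.le⟩
  subst hv
  have := Fintype.ofFinite W
  obtain ⟨p, hp⟩ := exists_isLocalizer W v
  have hg (g : W) : g • (p * p) * a ∈ fibreIdeal (⊤ : Subgroup W) v := by
    have hmem : g⁻¹ • a ∈ fibreIdeal (MulAction.stabilizer W v) v :=
      (restrictCo_eq_zero_iff le_rfl).1 (congrFun (congrArg Subtype.val ha) g)
    have h := smul_mem_fibreIdeal_top g (hp.mul_mul_mem hmem)
    rwa [← mul_assoc, smul_mul', smul_inv_smul] at h
  have hsum : (∑ g : W, g • (p * p)) * a ∈ fibreIdeal (⊤ : Subgroup W) v := by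
    rw [Finset.sum_mul]
    exact sum_mem fun g _ => hg g
  refine mem_fibreIdeal_of_mul_mem (fun w => smul_sum_smul (w : W) _) ?_ hsum
  have hval (g : W) : evalAt v (g • (p * p)) =
      if g ∈ MulAction.stabilizer W v then 1 else 0 := by
    rw [smul_mul', map_mul]
    split_ifs with h
    · rw [show g • p = p from hp.smul_eq ⟨g, h⟩, hp.evalAt_eq_one, one_mul]
    · rw [hp.evalAt_smul_eq_zero g h, zero_mul]
  rw [map_sum]
  simp only [hval]
  rw [Finset.sum_boole, Nat.cast_ne_zero, Finset.card_ne_zero]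
  exact ⟨1, by simp⟩

end Fibre

/-! ### Parabolic subgroups -/

section Parabolic

variable {V : Type} [AddCommGroup V] [Module ℂ V] {W : Subgroup (V ≃ₗ[ℂ] V)}

theorem mem_pointwiseStabilizer_iff_le {X : Submodule ℂ V} {w : W} :
    w ∈ pointwiseStabilizer W X ↔ X ≤ fixedSpace (w : V ≃ₗ[ℂ] V) :=
  mem_fixingSubgroup_iff W

theorem le_of_pointwiseStabilizer_le {X Y : Submodule ℂ V} (hY : Y ∈ intersections W)
    (h : pointwiseStabilizer W Y ≤ pointwiseStabilizer W X) : X ≤ Y := by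
  obtain ⟨B, hB, rfl⟩ := hY
  refine le_sInf fun a ha => ?_
  obtain ⟨r, hr, -, rfl⟩ := hB ha
  have hrB : (⟨r, hr⟩ : W) ∈ pointwiseStabilizer W (sInf B) :=
    mem_pointwiseStabilizer_iff_le.2 (sInf_le ha)
  exact mem_pointwiseStabilizer_iff_le.1 (h hrB)

theorem pointwiseStabilizer_injective :
    Function.Injective fun X : intersections W => pointwiseStabilizer W X.1 :=
  fun X Y h => Subtype.ext <| le_antisymm (le_of_pointwiseStabilizer_le Y.2 h.ge)
    (le_of_pointwiseStabilizer_le X.2 h.le)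

theorem pointwiseStabilizer_smul (w : W) (X : intersections W) :
    pointwiseStabilizer W (w • X).1 =
      (pointwiseStabilizer W X.1).map (MulAut.conj w).toMonoidHom := by
  ext u
  rw [Subgroup.mem_map_equiv, MulAut.conj_symm_apply, pointwiseStabilizer, pointwiseStabilizer,
    mem_fixingSubgroup_iff, mem_fixingSubgroup_iff]
  refine Set.forall_mem_image.trans (forall₂_congr fun x _ => ?_)
  rw [mul_smul, mul_smul, inv_smul_eq_iff]
  rfl

theorem exists_pointwiseStabilizer_eq_stabilizer [Finite W] (X : Submodule ℂ V) :
    ∃ v : V, pointwiseStabilizer W X = MulAction.stabilizer W v := by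
  classical
  have := Fintype.ofFinite W
  let fixedInX (w : W) : Subspace ℂ X := (fixedSpace (w : V ≃ₗ[ℂ] V)).comap X.subtype
  have hproper : ⊤ ∉ {w | w ∉ pointwiseStabilizer W X}.toFinset.image fixedInX := fun h => by
    obtain ⟨w, hw, htop⟩ := Finset.mem_image.1 h
    refine Set.mem_toFinset.1 hw (mem_pointwiseStabilizer_iff_le.2 ?_)
    rwa [Submodule.comap_subtype_eq_top] at htop
  obtain ⟨⟨v, hv⟩, hgeneric⟩ := (Set.ne_univ_iff_exists_notMem _).1
    (Subspace.biUnion_ne_univ_of_top_notMem hproper)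
  refine ⟨v, le_antisymm (fun w hw => (mem_fixingSubgroup_iff W).1 hw v hv) fun w hw => ?_⟩
  by_contra hwX
  exact hgeneric (Set.mem_iUnion₂.2 ⟨fixedInX w,
    Finset.mem_image_of_mem _ (Set.mem_toFinset.2 hwX), hw⟩)

theorem IsReflectionGroup.exists_pointwiseStabilizer_eq [FiniteDimensional ℂ V]
    (hW : IsReflectionGroup W) (v : V) :
    ∃ X : intersections W, pointwiseStabilizer W X.1 = MulAction.stabilizer W v := by
  refine ⟨⟨sInf {a | a ∈ mirrors W ∧ v ∈ a}, _, fun a ha => ha.1, rfl⟩, le_antisymm ?_ ?_⟩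
  · intro w hw
    exact (mem_fixingSubgroup_iff W).1 hw v (Submodule.mem_sInf.2 fun a ha => ha.2)
  · exact hW.stabilizer_le fun r hr hrv =>
      mem_pointwiseStabilizer_iff_le.2 (sInf_le ⟨⟨r, r.2, hr, rfl⟩, hrv⟩)

end Parabolic

/-! ### Equivariant base change -/

section BaseChange

universe v u

variable {𝒞 : Type u} [Category.{v} 𝒞] {R S T : 𝒞} {G : Type*} [Monoid G]

/-- The `G`-object `C` over `S` is the base change along `φ` of the `G`-object `D` over `T`, by
means of the equivariant projection `f`. -/
structure IsBaseChange (φ : S ⟶ T) {C : Action (Over S) G} {D : Action (Over T) G}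
    (f : C.V.left ⟶ D.V.left) : Prop where
  isPullback : IsPullback f C.V.hom D.V.hom φ
  comm (g : G) : (C.ρ g).left ≫ f = f ≫ (D.ρ g).left

theorem isBaseChange_id (C : Action (Over S) G) : IsBaseChange (C := C) (D := C) (𝟙 S) (𝟙 _) where
  isPullback := IsPullback.id_horiz _
  comm _ := (Category.comp_id _).trans (Category.id_comp _).symm

theorem isBaseChange_pullback [HasPullbacks 𝒞] (φ : S ⟶ T) (D : Action (Over T) G) :
    IsBaseChange (C := ((Over.pullback φ).mapAction G).obj D) (D := D) φ
      (pullback.fst D.V.hom φ) where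
  isPullback := IsPullback.of_hasPullback _ _
  comm _ := pullback.lift_fst _ _ _

namespace IsBaseChange

variable {φ : S ⟶ T} {C C' : Action (Over S) G} {D : Action (Over T) G}
  {f : C.V.left ⟶ D.V.left} {f' : C'.V.left ⟶ D.V.left}

theorem comp {p : R ⟶ S} {B : Action (Over R) G} {k : B.V.left ⟶ C.V.left}
    (hk : IsBaseChange p k) (hf : IsBaseChange φ f) : IsBaseChange (p ≫ φ) (k ≫ f) where
  isPullback := hk.isPullback.paste_horiz hf.isPullback
  comm g := by rw [reassoc_of% hk.comm g, hf.comm g, Category.assoc]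

theorem of_iso (hf : IsBaseChange φ f) (e : C' ≅ C) : IsBaseChange φ (e.hom.hom.left ≫ f) where
  isPullback :=
    let i : C'.V.left ≅ C.V.left := (Over.forget S).mapIso ((Action.forget _ G).mapIso e)
    hf.isPullback.of_iso i.symm (Iso.refl _) (Iso.refl _) (Iso.refl _)
      ((Category.comp_id f).trans (i.inv_hom_id_assoc f).symm)
      ((Category.comp_id _).trans (Over.w e.inv.hom).symm) (by simp) (by simp)
  comm g := by
    rw [← Over.comp_left_assoc, e.hom.comm g, Over.comp_left_assoc, hf.comm g, Category.assoc]

theorem section_ext (hf : IsBaseChange φ f) {σ τ : Over.mk (𝟙 S) ⟶ C.V}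
    (h : σ.left ≫ f = τ.left ≫ f) : σ = τ :=
  Over.OverMorphism.ext <| hf.isPullback.hom_ext h <| (Over.w σ).trans (Over.w τ).symm

theorem exists_iso (hf : IsBaseChange φ f) (hf' : IsBaseChange φ f') :
    ∃ e : C ≅ C', e.hom.hom.left ≫ f' = f := by
  let i : C.V ≅ C'.V := Over.isoMk (hf.isPullback.isoIsPullback _ _ hf'.isPullback)
    (hf.isPullback.isoIsPullback_hom_snd _ _ hf'.isPullback)
  have hi : i.hom.left ≫ f' = f := hf.isPullback.isoIsPullback_hom_fst _ _ hf'.isPullback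
  refine ⟨Action.mkIso i fun g => Over.OverMorphism.ext (hf'.isPullback.hom_ext ?_ ?_), hi⟩
  · rw [Over.comp_left, Over.comp_left, Category.assoc, Category.assoc, hi, hf'.comm g,
      reassoc_of% hi, hf.comm g]
  · exact (Over.w (C.ρ g ≫ i.hom)).trans (Over.w (i.hom ≫ C'.ρ g)).symm

end IsBaseChange

end BaseChange

/-! ### Points -/

section HomAction

universe v u

variable {𝒞 : Type u} [Category.{v} 𝒞] {G : Type*} [Group G] {A : 𝒞} {C D : Action 𝒞 G}

/-- The action of `G` on the points of a `G`-object. -/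
instance homMulAction : MulAction G (A ⟶ C.V) where
  smul g σ := σ ≫ C.ρ g
  one_smul σ := (congrArg (σ ≫ ·) (map_one C.ρ)).trans (Category.comp_id σ)
  mul_smul g h σ := (congrArg (σ ≫ ·) (map_mul C.ρ g h)).trans (Category.assoc _ _ _).symm

theorem smul_hom_def (g : G) (σ : A ⟶ C.V) : g • σ = σ ≫ C.ρ g := rfl

theorem smul_comp_hom (g : G) (σ : A ⟶ C.V) (f : C ⟶ D) :
    (g • σ) ≫ f.hom = g • (σ ≫ f.hom) := by
  rw [smul_hom_def, smul_hom_def, Category.assoc, Category.assoc, f.comm]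

theorem stabilizer_comp_hom (e : C ≅ D) (σ : A ⟶ C.V) :
    MulAction.stabilizer G (σ ≫ e.hom.hom) = MulAction.stabilizer G σ := by
  ext g
  rw [MulAction.mem_stabilizer_iff, MulAction.mem_stabilizer_iff, ← smul_comp_hom, cancel_mono]

end HomAction

theorem exists_section_of_locallyOfFiniteType {K : Type*} [Field K] [IsAlgClosed K] {U : Scheme}
    (u : U ⟶ Spec (.of K)) [LocallyOfFiniteType u] [Surjective u] :
    ∃ p : Spec (.of K) ⟶ U, p ≫ u = 𝟙 _ := by
  have : JacobsonSpace U := LocallyOfFiniteType.jacobsonSpace u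
  have hU : (closure (closedPoints U)).Nonempty := by
    rw [closure_closedPoints]
    exact ⟨_, Set.mem_univ (u.surjective (IsLocalRing.closedPoint K)).choose⟩
  obtain ⟨x, hx⟩ := closure_nonempty_iff.1 hU
  exact ⟨pointOfClosedPoint u x hx, pointOfClosedPoint_comp u x hx⟩

section PointsOfQuotient

variable {V : Type} [AddCommGroup V] [Module ℂ V] {W : Subgroup (V ≃ₗ[ℂ] V)}

variable (W) in
/-- The complex point of the scheme `V` given by a vector `v`. -/
def spacePoint (v : V) : Spec (.of ℂ) ⟶ (tautologicalCover W).V.left :=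
  Spec.map (CommRingCat.ofHom (evalAt v : Coord V →+* ℂ))

variable (W) in
/-- The image of the vector `v` in the quotient scheme `V/W`. -/
def quotientPoint (v : V) : Spec (.of ℂ) ⟶ quotientScheme W :=
  Spec.map (CommRingCat.ofHom ((evalAt v).comp (Invariants W).val : Invariants W →+* ℂ))

theorem spacePoint_comp_hom (v : V) :
    spacePoint W v ≫ (tautologicalCover W).V.hom = quotientPoint W v :=
  (Spec.map_comp _ _).symm

theorem spacePoint_comp_ρ (w : W) (v : V) :
    spacePoint W v ≫ ((tautologicalCover W).ρ w).left = spacePoint W (w • v) := by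
  refine (Spec.map_comp _ _).symm.trans ?_
  refine congrArg Spec.map (CommRingCat.hom_ext (RingHom.ext fun a => ?_))
  refine (evalAt_smul w⁻¹ v a).trans ?_
  rw [inv_inv]
  rfl

theorem quotientPoint_comp (v : V) : quotientPoint W v ≫ quotientToSpec W = 𝟙 _ :=
  (specMap_comp_algebraMap ((evalAt v).comp (Invariants W).val)).trans (Spec.map_id _)

theorem quotientPoint_smul (w : W) (v : V) : quotientPoint W (w • v) = quotientPoint W v := by
  rw [← spacePoint_comp_hom, ← spacePoint_comp_ρ, Category.assoc, Over.w, spacePoint_comp_hom]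

theorem spacePoint_injective : Function.Injective (spacePoint W) := fun _ _ h =>
  evalAt_injective <| AlgHom.coe_ringHom_injective <|
    congrArg CommRingCat.Hom.hom (Spec.map_injective h)

theorem exists_smul_eq_of_quotientPoint_eq [FiniteDimensional ℂ V] [Finite W] {x y : V}
    (h : quotientPoint W x = quotientPoint W y) : ∃ w : W, w • x = y := by
  obtain ⟨w, -, hw⟩ := exists_smul_eq_of_forall_evalAt_eq (N := (⊤ : Subgroup W)) fun a ha =>
    RingHom.congr_fun (congrArg CommRingCat.Hom.hom (Spec.map_injective h))
      (⟨a, fun w => ha w trivial⟩ : Invariants W)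
  exact ⟨w, hw⟩

theorem tautologicalCover_hom_comp : (tautologicalCover W).V.hom ≫ quotientToSpec W =
    Spec.map (CommRingCat.ofHom (algebraMap ℂ (Coord V))) :=
  (Spec.map_comp _ _).symm

theorem exists_eq_spacePoint [FiniteDimensional ℂ V]
    {p : Spec (.of ℂ) ⟶ (tautologicalCover W).V.left}
    (hp : p ≫ (tautologicalCover W).V.hom ≫ quotientToSpec W = 𝟙 _) :
    ∃ v, p = spacePoint W v := by
  obtain ⟨f, rfl⟩ : ∃ f : CommRingCat.of (Coord V) ⟶ CommRingCat.of ℂ, Spec.map f = p :=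
    ⟨Spec.preimage _, Spec.map_preimage _⟩
  have hf : CommRingCat.ofHom (algebraMap ℂ (Coord V)) ≫ f = 𝟙 _ := Spec.map_injective <| by
    rw [Spec.map_comp, Spec.map_id, ← hp, tautologicalCover_hom_comp]
    rfl
  obtain ⟨v, hv⟩ := exists_eq_evalAt
    ({ f.hom with commutes' := RingHom.congr_fun (congrArg CommRingCat.Hom.hom hf) } :
      Coord V →ₐ[ℂ] ℂ)
  exact ⟨v, congrArg Spec.map (CommRingCat.hom_ext (RingHom.ext fun a => DFunLike.congr_fun hv a))⟩

instance [FiniteDimensional ℂ V] [Finite W] : IsFinite (tautologicalCover W).V.hom :=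
  (IsFinite.SpecMap_iff _).2 <| RingHom.finite_algebraMap.2 inferInstance

instance [Finite W] : Surjective (tautologicalCover W).V.hom where
  surj :=
    have := Algebra.IsInvariant.isIntegral (Invariants W) (Coord V) W
    Algebra.IsIntegral.comap_surjective (Invariants W) (Coord V)

end PointsOfQuotient

universe u in
theorem isPushout_of_ker_le_map {A B K R : Type u} [CommRing A] [CommRing B] [CommRing K]
    [CommRing R] {f : B →+* A} {χ : B →+* K} {Θ : A →+* R} {κ : K →+* R}
    (h : Θ.comp f = κ.comp χ) (hΘ : Function.Surjective Θ) (hχ : Function.Surjective χ)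
    (hker : RingHom.ker Θ ≤ (RingHom.ker χ).map f) :
    IsPushout (CommRingCat.ofHom f) (CommRingCat.ofHom χ) (CommRingCat.ofHom Θ)
      (CommRingCat.ofHom κ) := by
  have hcond (s : PushoutCocone (CommRingCat.ofHom f) (CommRingCat.ofHom χ)) (b : B) :
      s.inl.hom (f b) = s.inr.hom (χ b) :=
    RingHom.congr_fun (congrArg CommRingCat.Hom.hom s.condition) b
  have hs (s : PushoutCocone (CommRingCat.ofHom f) (CommRingCat.ofHom χ)) :
      RingHom.ker Θ ≤ RingHom.ker s.inl.hom :=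
    hker.trans (Ideal.map_le_iff_le_comap.2 fun b hb => by
      rw [Ideal.mem_comap, RingHom.mem_ker, hcond, hb, map_zero])
  refine ⟨⟨CommRingCat.hom_ext h⟩, ⟨PushoutCocone.IsColimit.mk _
    (fun s => CommRingCat.ofHom (Θ.liftOfSurjective hΘ ⟨s.inl.hom, hs s⟩))
    (fun s => CommRingCat.hom_ext (RingHom.liftOfSurjective_comp _ _ _)) (fun s => ?_)
    (fun s m hm _ => CommRingCat.hom_ext (RingHom.eq_liftOfSurjective _ _ _ _ _
      (congrArg CommRingCat.Hom.hom hm)))⟩⟩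
  refine CommRingCat.hom_ext (RingHom.ext fun c => ?_)
  obtain ⟨b, rfl⟩ := hχ c
  exact (congrArg (Θ.liftOfSurjective hΘ ⟨s.inl.hom, hs s⟩) (RingHom.congr_fun h b).symm).trans
    ((RingHom.liftOfSurjective_comp_apply Θ hΘ _ (f b)).trans (hcond s b))

section InducedFibre

variable {V : Type} [AddCommGroup V] [Module ℂ V] {W : Subgroup (V ≃ₗ[ℂ] V)}
  {X : Submodule ℂ V} {v : V}

theorem IsBaseChange.exists_spacePoint [FiniteDimensional ℂ V]
    {q : Spec (.of ℂ) ⟶ quotientScheme W}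
    {C : Action (Over (Spec (.of ℂ))) W} {f : C.V.left ⟶ (tautologicalCover W).V.left}
    (hf : IsBaseChange q f) (hq : q ≫ quotientToSpec W = 𝟙 _)
    (σ : Over.mk (𝟙 (Spec (.of ℂ))) ⟶ C.V) :
    ∃ v, q = quotientPoint W v ∧ σ.left ≫ f = spacePoint W v := by
  have hσ : (σ.left ≫ f) ≫ (tautologicalCover W).V.hom = q := by
    rw [Category.assoc, hf.isPullback.w, reassoc_of% Over.w σ]
    exact Category.id_comp q
  obtain ⟨v, hv⟩ := exists_eq_spacePoint (W := W) (p := σ.left ≫ f) (by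
    rw [← Category.assoc, hσ, hq])
  exact ⟨v, by rw [← hσ, hv, spacePoint_comp_hom], hv⟩

/-- The morphism `ind_{W_X}^W Co(W_X, V) ⟶ V` that maps the class of `(w, d)` to `w(v + d)`, for a
point `v` fixed by `W_X`. -/
def indCoToSpace (hv : pointwiseStabilizer W X ≤ MulAction.stabilizer W v) :
    (indCo W X).V.left ⟶ (tautologicalCover W).V.left :=
  Spec.map (CommRingCat.ofHom (fibreHom hv :
    Coord V →+* inducedAlgebra (coinvariantsAut (pointwiseStabilizer W X))))

theorem indCoPt_comp_indCoToSpace (hv : pointwiseStabilizer W X ≤ MulAction.stabilizer W v) :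
    (indCoPt W X).left ≫ indCoToSpace hv = spacePoint W v := by
  refine (Spec.map_comp _ _).symm.trans (congrArg Spec.map (CommRingCat.hom_ext ?_))
  refine RingHom.ext fun a => ?_
  refine (congrArg (fun b => coinvariantsPoint (pointwiseStabilizer W X) (restrictCo _ v b))
    (?_ : (1 : W)⁻¹ • a = a)).trans (coinvariantsPoint_restrictCo (pointwiseStabilizer W X) v a)
  rw [inv_one, one_smul]

variable [FiniteDimensional ℂ V] [Finite W]

theorem isPushout_fibreHom {H : Subgroup W} (hv : H = MulAction.stabilizer W v) :
    IsPushout (CommRingCat.ofHom (algebraMap (Invariants W) (Coord V)))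
      (CommRingCat.ofHom ((evalAt v).comp (Invariants W).val : Invariants W →+* ℂ))
      (CommRingCat.ofHom (fibreHom hv.le : Coord V →+* inducedAlgebra (coinvariantsAut H)))
      (CommRingCat.ofHom (S := inducedAlgebra (coinvariantsAut H)) (algebraMap ℂ _)) := by
  refine isPushout_of_ker_le_map (RingHom.ext fun b => ?_) (fibreHom_surjective hv)
    (fun c => ⟨algebraMap ℂ _ c, AlgHom.commutes _ c⟩) fun a ha => ?_
  · have h := fibreHom_eq_zero_of_mem hv.le
      (sub_algebraMap_mem_fibreIdeal (H := (⊤ : Subgroup W)) (fun h => b.2 h) v)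
    rw [map_sub, AlgHom.commutes, sub_eq_zero] at h
    exact h
  · exact Ideal.span_le.2 (fun b hb => Ideal.mem_map_of_mem (algebraMap (Invariants W) (Coord V))
      (x := ⟨b, fun w => hb.1 ⟨w, trivial⟩⟩) hb.2) ((fibreHom_eq_zero_iff hv).1 ha)

theorem isBaseChange_indCoToSpace (hv : pointwiseStabilizer W X = MulAction.stabilizer W v) :
    IsBaseChange (C := indCo W X) (D := tautologicalCover W) (quotientPoint W v)
      (indCoToSpace hv.le) where
  isPullback := isPullback_SpecMap_of_isPushout _ _ _ _ (isPushout_fibreHom hv)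
  comm g := by
    refine (Spec.map_comp _ _).symm.trans (Eq.trans (congrArg Spec.map (CommRingCat.hom_ext ?_))
      (Spec.map_comp _ _))
    exact RingHom.ext (inducedAut_toInduced (restrictCo_smul hv.le) g⁻¹)

theorem smul_indCoPt_comp_indCoToSpace (hv : pointwiseStabilizer W X = MulAction.stabilizer W v)
    (w : W) : (w • indCoPt W X).left ≫ indCoToSpace hv.le = spacePoint W (w • v) := by
  rw [smul_hom_def, Over.comp_left, Category.assoc, (isBaseChange_indCoToSpace hv).comm,
    ← Category.assoc, indCoPt_comp_indCoToSpace, spacePoint_comp_ρ]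

theorem stabilizer_indCoPt (X : Submodule ℂ V) :
    MulAction.stabilizer W (indCoPt W X) = pointwiseStabilizer W X := by
  obtain ⟨v, hv⟩ := exists_pointwiseStabilizer_eq_stabilizer (W := W) X
  ext w
  rw [hv, MulAction.mem_stabilizer_iff, MulAction.mem_stabilizer_iff,
    ← (spacePoint_injective (W := W)).eq_iff, ← smul_indCoPt_comp_indCoToSpace hv,
    ← indCoPt_comp_indCoToSpace hv.le]
  exact ⟨fun h => by rw [h], (isBaseChange_indCoToSpace hv).section_ext⟩

theorem exists_smul_indCoPt_eq (σ : Over.mk (𝟙 (Spec (.of ℂ))) ⟶ (indCo W X).V) :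
    ∃ w : W, w • indCoPt W X = σ := by
  obtain ⟨v, hv⟩ := exists_pointwiseStabilizer_eq_stabilizer (W := W) X
  obtain ⟨x, hx, hσ⟩ := (isBaseChange_indCoToSpace hv).exists_spacePoint (quotientPoint_comp v) σ
  obtain ⟨w, rfl⟩ := exists_smul_eq_of_quotientPoint_eq hx
  exact ⟨w, (isBaseChange_indCoToSpace hv).section_ext <|
    (smul_indCoPt_comp_indCoToSpace hv w).trans hσ.symm⟩

end InducedFibre

/-! ### Cameral covers of a point -/

section CoversOfPoint

variable {V : Type} [AddCommGroup V] [Module ℂ V] {W : Subgroup (V ≃ₗ[ℂ] V)}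

theorem IsBaseChange.isCameralCover {C : Action (Over (Spec (.of ℂ))) W}
    {q : Spec (.of ℂ) ⟶ quotientScheme W} {f : C.V.left ⟶ (tautologicalCover W).V.left}
    (hf : IsBaseChange q f) (hq : q ≫ quotientToSpec W = 𝟙 _) :
    IsCameralCover W (𝟙 (Spec (.of ℂ))) C := by
  obtain ⟨e, -⟩ := (isBaseChange_pullback q (tautologicalCover W)).exists_iso hf
  obtain ⟨i, -⟩ := (isBaseChange_id C).exists_iso (isBaseChange_pullback (𝟙 _) C)
  exact ⟨_, 𝟙 _, q, inferInstance, inferInstance, hq.trans (Category.id_comp _).symm, ⟨e ≪≫ i⟩⟩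

theorem IsCameralCover.exists_isBaseChange {C : Action (Over (Spec (.of ℂ))) W}
    (hC : IsCameralCover W (𝟙 (Spec (.of ℂ))) C) :
    ∃ (q : Spec (.of ℂ) ⟶ quotientScheme W) (f : C.V.left ⟶ (tautologicalCover W).V.left),
      q ≫ quotientToSpec W = 𝟙 _ ∧ IsBaseChange q f := by
  obtain ⟨U, u, φ, hu, hsurj, hφ, ⟨e⟩⟩ := hC
  obtain ⟨p, hp⟩ := exists_section_of_locallyOfFiniteType u
  have hC' := (isBaseChange_pullback p _).comp (isBaseChange_pullback u C)
  rw [hp] at hC'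
  obtain ⟨i, -⟩ := (isBaseChange_id C).exists_iso hC'
  have hD := (isBaseChange_pullback p _).comp (isBaseChange_pullback φ (tautologicalCover W))
  refine ⟨p ≫ φ, _, ?_, hD.of_iso (i ≪≫ (((Over.pullback p).mapAction W).mapIso e).symm)⟩
  rw [Category.assoc, hφ, Category.comp_id, hp]

theorem IsCameralCover.exists_section [FiniteDimensional ℂ V] [Finite W]
    {C : Action (Over (Spec (.of ℂ))) W} (hC : IsCameralCover W (𝟙 (Spec (.of ℂ))) C) :
    Nonempty (Over.mk (𝟙 (Spec (.of ℂ))) ⟶ C.V) := by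
  obtain ⟨q, f, -, hf⟩ := hC.exists_isBaseChange
  have : IsFinite C.V.hom := MorphismProperty.of_isPullback hf.isPullback inferInstance
  have : Surjective C.V.hom := MorphismProperty.of_isPullback hf.isPullback inferInstance
  obtain ⟨σ, hσ⟩ := exists_section_of_locallyOfFiniteType C.V.hom
  exact ⟨Over.homMk σ hσ⟩

variable [FiniteDimensional ℂ V]

theorem isCameralCover_indCo [Finite W] (X : Submodule ℂ V) :
    IsCameralCover W (𝟙 (Spec (.of ℂ))) (indCo W X) := by
  obtain ⟨v, hv⟩ := exists_pointwiseStabilizer_eq_stabilizer (W := W) X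
  exact (isBaseChange_indCoToSpace hv).isCameralCover (quotientPoint_comp v)

theorem IsCameralCover.exists_iso_indCo_of_section {C : Action (Over (Spec (.of ℂ))) W}
    (hC : IsCameralCover W (𝟙 (Spec (.of ℂ))) C) (hW : IsReflectionGroup W)
    (σ : Over.mk (𝟙 (Spec (.of ℂ))) ⟶ C.V) :
    ∃ X : intersections W, ∃ e : C ≅ indCo W X.1, σ ≫ e.hom.hom = indCoPt W X.1 := by
  have := hW.finite
  obtain ⟨q, f, hq, hf⟩ := hC.exists_isBaseChange
  obtain ⟨v, rfl, hσ⟩ := hf.exists_spacePoint hq σ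
  obtain ⟨X, hX⟩ := hW.exists_pointwiseStabilizer_eq v
  obtain ⟨e, he⟩ := hf.exists_iso (isBaseChange_indCoToSpace hX)
  refine ⟨X, e, (isBaseChange_indCoToSpace hX).section_ext ?_⟩
  rw [Over.comp_left, Category.assoc, he, hσ, indCoPt_comp_indCoToSpace]

theorem IsCameralCover.exists_iso_indCo {C : Action (Over (Spec (.of ℂ))) W}
    (hC : IsCameralCover W (𝟙 (Spec (.of ℂ))) C) (hW : IsReflectionGroup W) :
    ∃ X : intersections W, Nonempty (C ≅ indCo W X.1) := by
  have := hW.finite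
  obtain ⟨σ⟩ := hC.exists_section
  obtain ⟨X, e, -⟩ := hC.exists_iso_indCo_of_section hW σ
  exact ⟨X, ⟨e⟩⟩

variable [Finite W]

theorem nonempty_indCo_smul_iso (w : W) (X : intersections W) :
    Nonempty (indCo W (w • X).1 ≅ indCo W X.1) := by
  obtain ⟨v, hv⟩ := exists_pointwiseStabilizer_eq_stabilizer (W := W) X.1
  have hwv : pointwiseStabilizer W (w • X).1 = MulAction.stabilizer W (w • v) := by
    rw [pointwiseStabilizer_smul, hv, MulAction.stabilizer_smul_eq_stabilizer_map_conj]
  have h := isBaseChange_indCoToSpace hwv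
  rw [quotientPoint_smul] at h
  exact ⟨(h.exists_iso (isBaseChange_indCoToSpace hv)).choose⟩

theorem eq_of_indCo_iso_of_comp_eq {X Y : intersections W} (e : indCo W X.1 ≅ indCo W Y.1)
    (he : indCoPt W X.1 ≫ e.hom.hom = indCoPt W Y.1) : X = Y :=
  pointwiseStabilizer_injective <| by
    change pointwiseStabilizer W X.1 = pointwiseStabilizer W Y.1
    rw [← stabilizer_indCoPt, ← stabilizer_indCoPt, ← he, stabilizer_comp_hom]

theorem exists_smul_eq_of_indCo_iso {X Y : intersections W} (e : indCo W X.1 ≅ indCo W Y.1) :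
    ∃ w : W, w • Y = X := by
  obtain ⟨w, hw⟩ := exists_smul_indCoPt_eq (indCoPt W X.1 ≫ e.hom.hom)
  refine ⟨w, pointwiseStabilizer_injective ?_⟩
  change pointwiseStabilizer W (w • Y).1 = pointwiseStabilizer W X.1
  rw [pointwiseStabilizer_smul, ← stabilizer_indCoPt, ← stabilizer_indCoPt,
    ← MulAction.stabilizer_smul_eq_stabilizer_map_conj, hw, stabilizer_comp_hom]

variable (W)

/-- The isomorphism class of the pointed cameral cover `(ind_{W_X}^W Co(W_X, V), σ_X)`. -/
def pointedIndCoClass (X : intersections W) :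
    PointedCameralCoverClass W (𝟙 (Spec (.of ℂ))) :=
  Quotient.mk _ ⟨indCo W X.1, isCameralCover_indCo X.1, indCoPt W X.1⟩

/-- The isomorphism class of the cameral cover `ind_{W_X}^W Co(W_X, V)`, as a function of the orbit
of `X`. -/
def indCoClass : MulAction.orbitRel.Quotient W (intersections W) →
    CameralCoverClass W (𝟙 (Spec (.of ℂ))) :=
  Quotient.lift (fun X => Quotient.mk _ ⟨indCo W X.1, isCameralCover_indCo X.1⟩) <| by
    rintro _ X ⟨w, rfl⟩
    obtain ⟨e⟩ := nonempty_indCo_smul_iso w X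
    exact Quotient.sound ⟨ObjectProperty.isoMk _ e⟩

variable {W}

theorem IsReflectionGroup.bijective_pointedIndCoClass (hW : IsReflectionGroup W) :
    Function.Bijective (pointedIndCoClass W) := by
  constructor
  · intro X Y h
    obtain ⟨e, he⟩ := Quotient.exact h
    exact eq_of_indCo_iso_of_comp_eq e he
  · rintro ⟨C⟩
    obtain ⟨X, e, he⟩ := C.isCameralCover.exists_iso_indCo_of_section hW C.pt
    exact ⟨X, Eq.symm (Quotient.sound ⟨e, he⟩)⟩

theorem IsReflectionGroup.bijective_indCoClass (hW : IsReflectionGroup W) :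
    Function.Bijective (indCoClass W) := by
  constructor
  · rintro ⟨X⟩ ⟨Y⟩ h
    obtain ⟨e⟩ := Quotient.exact h
    obtain ⟨w, hw⟩ := exists_smul_eq_of_indCo_iso ((ObjectProperty.ι _).mapIso e)
    exact Quotient.sound ⟨w, hw⟩
  · rintro ⟨C⟩
    obtain ⟨X, ⟨e⟩⟩ := C.property.exists_iso_indCo hW
    exact ⟨Quotient.mk _ X, Eq.symm (Quotient.sound ⟨ObjectProperty.isoMk _ e⟩)⟩

end CoversOfPoint

end Cameral

end

theorem mainTheorem7 (V : Type) [AddCommGroup V] [Module ℂ V] [FiniteDimensional ℂ V]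
    (W : Subgroup (V ≃ₗ[ℂ] V)) (hW : Cameral.IsReflectionGroup W) :
    ∃ (hind : ∀ X : Cameral.intersections W,
        Cameral.IsCameralCover W (𝟙 (Spec (.of ℂ))) (Cameral.indCo W X.1))
      (Φ : Cameral.intersections W ≃
        Cameral.PointedCameralCoverClass W (𝟙 (Spec (.of ℂ))))
      (Ψ : MulAction.orbitRel.Quotient W (Cameral.intersections W) ≃
        Cameral.CameralCoverClass W (𝟙 (Spec (.of ℂ)))),
      (∀ X : Cameral.intersections W,
        Φ X = Quotient.mk _ ⟨Cameral.indCo W X.1, hind X, Cameral.indCoPt W X.1⟩) ∧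
      (∀ X : Cameral.intersections W,
        Ψ (Quotient.mk _ X) = Quotient.mk _ ⟨Cameral.indCo W X.1, hind X⟩) ∧
      (∀ C : Cameral.PointedCameralCover W (𝟙 (Spec (.of ℂ))), ∃ X : Cameral.intersections W,
        ∃ e : C.cover ≅ Cameral.indCo W X.1, C.pt ≫ e.hom.hom = Cameral.indCoPt W X.1) ∧
      (∀ C : Cameral.CameralCover W (𝟙 (Spec (.of ℂ))), ∃ X : Cameral.intersections W,
        Nonempty (C.obj ≅ Cameral.indCo W X.1)) := by
  have := hW.finite
  exact ⟨fun X => Cameral.isCameralCover_indCo X.1,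
    .ofBijective _ hW.bijective_pointedIndCoClass, .ofBijective _ hW.bijective_indCoClass,
    fun _ => rfl, fun _ => rfl,
    fun C => C.isCameralCover.exists_iso_indCo_of_section hW C.pt,
    fun C => C.property.exists_iso_indCo hW⟩
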